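/- Let $d\ge 2$ be an integer, $\alpha>\tfrac12$, $\beta\le 0$ with $\alpha+\beta>\tfrac12$, and put $T:=-\beta/\alpha\in[0,1)$. Notation. $\mathbb T^d=[0,1)^d$ is the torus with normalised measure, $\hat f_{k}=\int_{\mathbb T^d}f(x)e^{-2\pi i k\cdot x}\,dx$, and $\mathcal H^{\alpha,\beta}(\mathbb T^d)$ is the space of $f\in L_2(\mathbb T^d)$ with $$\|f|\mathcal H^{\alpha,\beta}\|^2=\sum_{k\in\mathbb Z^d}|\hat f_k|^2(1+\|k\|_2^2)^{\beta}\prod_{s=1}^d(1+|k_s|^2)^{\alpha}<\infty .$$ For $z\in\mathbb Z^d$, $M\in\mathbb N$, $M \geq 1$, the rank-1 lattice $\Lambda(z,M)$ has the nodes $\frac jM z \bmod 1$, $0\le j<M$. For a finite set $I\subset\mathbb Z^d$ and a continuous $f$ the sampling operator is $$S_I^{\Lambda(z,M)}f=\sum_{k\in I}\Big(\frac1M\sum_{j=0}^{M-1}f\big(\tfrac jM z\big)e^{-2\pi i \frac jM k\cdot z}\Big)e^{2\pi i k\cdot x},$$ and $\Lambda(z,M)$ is reconstructing for $I$ if $S_I^{\Lambda(z,M)}p=p$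 for all $p\in\operatorname{span}\{e^{2\pi i k\cdot x}:k\in I\}$. For real $R\ge1$ let $$H_R^{d,T}=\bigcup_{j\in J_R^{d,T}}Q_{j_1}\times\dots\times Q_{j_d},\qquad J_R^{d,T}=\{j\in\mathbb N_0^d:\|j\|_1-T\|j\|_\infty\le(1-T)R+d-1\},$$ where $Q_0=\{-1,0,1\}$ and $Q_j=\{k\in\mathbb Z:2^{j-1}+1\le|k|\le2^j\}$ for $j>0$. A reconstructing rank-1 lattice $\Lambda(z,M)$ for $I$ is said to be constructed by the component-by-component (CBC) strategy if there is an $N$ with $M\le N\le N_0(I)$ such that $z\in\{0,\dots,N-1\}^d$ is the result of a CBC search with lattice size $N$, that is, for $s=1,\dots,d$ successively, $z_s$ is chosen such that $\Lambda((z_1,\dots,z_s),N)$ is reconstructing for the projection of $I$ to the first $s$ coordinates. (So the lattice size may be decreased from $N$ to $M$ after the search, as long as $\Lambda(z,M)$ stays reconstructing.) Here $N_0(I)$ is the smallest prime that is at least $|\mathcal D(I)|$ and exceeds $\|h\|_\infty$ for all $h\in\mathcal D(I)$, where $\mathcal D(I)=\{k-l:k,l\in I\}$. Claim. Every $f\in\mathcal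 H^{\alpha,\beta}(\mathbb T^d)$ has a continuous representative (through which it is sampled), and there is a constant $C>0$ depending only on $d,\alpha,\beta$ such that the following holds for all real $R\ge1$. (i) For every reconstructing rank-1 lattice $\Lambda(z,M)$ for $H_R^{d,T}$ (in particular for one constructed by the CBC strategy), $$\big\|\mathrm{Id}-S_{H_R^{d,T}}^{\Lambda(z,M)}\,\big|\,\mathcal H^{\alpha,\beta}(\mathbb T^d)\to L_\infty(\mathbb T^d)\big\|\le C\,2^{-(\alpha+\beta-\frac12)R}\begin{cases}R^{\frac{d-1}2}&\beta=0,\\1&\beta<0.\end{cases}$$ (ii) There is a reconstructing rank-1 lattice for $H_R^{d,T}$ constructed by the CBC strategy, and for every such lattice $\Lambda(z,M)$ the factor following $C$ on the right-hand side of (i) and the norm on its left-hand side are both at most $$C\,M^{-(\alpha+\beta-\frac12)/2}\begin{cases}(\log M)^{\frac{d-2}2(\alpha-\frac12)+\frac{d-1}2}&\beta=0,\\1&\beta<0.\end{cases}$$ -/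

import Mathlib

open MeasureTheory UnitAddTorus
open scoped ENNReal

noncomputable section

/-- The normalised Haar (Lebesgue) measure on the torus `𝕋^d = [0,1)^d`. This is the measure with
respect to which Mathlib's Fourier coefficients `mFourierCoeff` are defined. -/
abbrev torusMeasure (d : ℕ) : Measure (UnitAddTorus (Fin d)) :=
  Measure.pi fun _ => AddCircle.haarAddCircle

/-- The norm `‖f | H^{α,β}(𝕋^d)‖` of hybrid mixed smoothness of `f ∈ L₂(𝕋^d)`, as an element of
`[0,∞]`: its square is `∑_k |f̂_k|² (1+‖k‖₂²)^β ∏_s (1+|k_s|²)^α`.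
The space `H^{α,β}(𝕋^d)` consists of the `f` for which it is finite. -/
def hybridNorm {d : ℕ} (α β : ℝ) (f : Lp ℂ 2 (torusMeasure d)) : ℝ≥0∞ :=
  (∑' k : Fin d → ℤ, ENNReal.ofReal
    (‖mFourierCoeff (f : UnitAddTorus (Fin d) → ℂ) k‖ ^ 2
      * (1 + ∑ s, (k s : ℝ) ^ 2) ^ β * ∏ s, (1 + (k s : ℝ) ^ 2) ^ α)) ^ (1 / 2 : ℝ)

/-- `g` is a continuous representative of the class `f`. -/
def IsContRep {d : ℕ} (f : Lp ℂ 2 (torusMeasure d)) (g : C(UnitAddTorus (Fin d), ℂ)) : Prop :=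
  (f : UnitAddTorus (Fin d) → ℂ) =ᵐ[torusMeasure d] g

open Classical in
/-- The continuous representative of `f ∈ L₂(𝕋^d)`; point evaluation of `f` is evaluation of this
function. (It is unique if it exists; the value is `0` if there is none.) -/
def contRep {d : ℕ} (f : Lp ℂ 2 (torusMeasure d)) : C(UnitAddTorus (Fin d), ℂ) :=
  if h : ∃ g, IsContRep f g then h.choose else 0

/-- The node `(j/M) z mod 1` of the rank-1 lattice `Λ(z,M)`. -/
def latticeNode {d : ℕ} (z : Fin d → ℤ) (M j : ℕ) : UnitAddTorus (Fin d) :=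
  fun s => (((j : ℝ) / (M : ℝ) * (z s : ℝ) : ℝ) : UnitAddCircle)

/-- The lattice rule for the Fourier coefficient,
`M⁻¹ ∑_{j<M} g((j/M) z) exp(-2πi (j/M) k·z)`. -/
def latticeCoeff {d : ℕ} (z : Fin d → ℤ) (M : ℕ) (g : C(UnitAddTorus (Fin d), ℂ))
    (k : Fin d → ℤ) : ℂ :=
  (1 / (M : ℂ)) * ∑ j ∈ Finset.range M, g (latticeNode z M j) * mFourier (-k) (latticeNode z M j)

/-- The rank-1 lattice sampling operator `S_I^{Λ(z,M)}` for a finite frequency set `I`. -/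
def latticeSampling {d : ℕ} (I : Set (Fin d → ℤ)) (z : Fin d → ℤ) (M : ℕ)
    (g : C(UnitAddTorus (Fin d), ℂ)) : C(UnitAddTorus (Fin d), ℂ) :=
  ∑ᶠ k ∈ I, latticeCoeff z M g k • mFourier k

/-- `Λ(z,M)`, `M ≥ 1`, is a reconstructing rank-1 lattice for `I`: the sampling operator reproduces
every trigonometric polynomial with frequencies in `I`. -/
def IsReconstructing {d : ℕ} (I : Set (Fin d → ℤ)) (z : Fin d → ℤ) (M : ℕ) : Prop :=
  0 < M ∧ ∀ p ∈ Submodule.span ℂ ((fun k : Fin d → ℤ => mFourier k) '' I),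
    latticeSampling I z M p = p

/-- The norm of `Id - S_I^{Λ(z,M)} : H^{α,β}(𝕋^d) → L_∞(𝕋^d)`. -/
def samplingError {d : ℕ} (α β : ℝ) (I : Set (Fin d → ℤ)) (z : Fin d → ℤ) (M : ℕ) : ℝ≥0∞ :=
  ⨆ (f : Lp ℂ 2 (torusMeasure d)) (_ : hybridNorm α β f ≤ 1),
    eLpNorm (fun x => f x - latticeSampling I z M (contRep f) x) ∞ (torusMeasure d)

/-- The dyadic block `Q_j ⊂ ℤ`. -/
def dyadicBlock (j : ℕ) : Set ℤ :=
  if j = 0 then {-1, 0, 1}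
  else Set.Icc (-2 ^ j) (-2 ^ (j - 1) - 1) ∪ Set.Icc (2 ^ (j - 1) + 1) (2 ^ j)

/-- `J_R^{d,T} = {j ∈ ℕ₀^d : ‖j‖₁ - T‖j‖_∞ ≤ (1-T)R + d - 1}`. -/
def hypCrossLevels (d : ℕ) (T R : ℝ) : Set (Fin d → ℕ) :=
  {j | (∑ s, (j s : ℝ)) - T * ((Finset.univ.sup j : ℕ) : ℝ) ≤ (1 - T) * R + d - 1}

/-- The generalized dyadic hyperbolic cross `H_R^{d,T} = ⋃_{j ∈ J_R^{d,T}} Q_{j_1} × ⋯ × Q_{j_d}`. -/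
def hypCross (d : ℕ) (T R : ℝ) : Set (Fin d → ℤ) :=
  ⋃ j ∈ hypCrossLevels d T R, Set.pi Set.univ fun s => dyadicBlock (j s)

/-- For `T < 1` the hyperbolic cross is finite, so that the sampling operator is a finite sum. -/
theorem hypCross_finite (d : ℕ) {T : ℝ} (hT : T < 1) (R : ℝ) : (hypCross d T R).Finite := by
  have hblock : ∀ j, (dyadicBlock j).Finite := by
    intro j
    unfold dyadicBlock
    split_ifs
    · exact Set.toFinite _
    · exact (Set.finite_Icc _ _).union (Set.finite_Icc _ _)
  refine Set.Finite.biUnion ?_ fun j _ => Set.Finite.pi fun s => hblock (j s)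
  obtain ⟨B, hB⟩ := exists_nat_ge (((1 - T) * R + d - 1) / (1 - T))
  refine (Set.finite_Iic (fun _ : Fin d => B)).subset ?_
  intro j hj
  have hj' : (∑ s, (j s : ℝ)) - T * ((Finset.univ.sup j : ℕ) : ℝ) ≤ (1 - T) * R + d - 1 := hj
  have hT' : 0 < 1 - T := by linarith
  intro i
  have hi : j i ≤ Finset.univ.sup j := Finset.le_sup (Finset.mem_univ i)
  have hsup : ((Finset.univ.sup j : ℕ) : ℝ) ≤ ∑ s, (j s : ℝ) := by
    obtain ⟨s, _, hs⟩ := Finset.exists_mem_eq_sup Finset.univ ⟨i, Finset.mem_univ i⟩ j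
    rw [hs]
    exact Finset.single_le_sum (f := fun s => (j s : ℝ)) (fun _ _ => Nat.cast_nonneg _)
      (Finset.mem_univ s)
  have h1 : (1 - T) * ((Finset.univ.sup j : ℕ) : ℝ) ≤ (1 - T) * R + d - 1 := by linarith
  have h2 : ((Finset.univ.sup j : ℕ) : ℝ) ≤ B := by
    refine le_trans ?_ hB
    rw [le_div_iff₀ hT']
    linarith
  exact hi.trans (by exact_mod_cast h2)

/-- The difference set `D(I)`. -/
def diffSet {d : ℕ} (I : Set (Fin d → ℤ)) : Set (Fin d → ℤ) :=
  {h | ∃ k ∈ I, ∃ l ∈ I, h = k - l}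

/-- The first `s` coordinates of a vector. -/
def firstCoords {d s : ℕ} (hs : s ≤ d) (k : Fin d → ℤ) : Fin s → ℤ :=
  fun i => k (Fin.castLE hs i)

/-- `z` is a possible result of the component-by-component search with lattice size `N`: its
components are chosen one after the other in `{0, …, N-1}`, the `s`-th one such that `(z_1,…,z_s)`
and `N` give a reconstructing rank-1 lattice for the projection of `I` to the first `s`
coordinates. -/
def IsCBCVector {d : ℕ} (I : Set (Fin d → ℤ)) (N : ℕ) (z : Fin d → ℤ) : Prop :=
  (∀ s, 0 ≤ z s ∧ z s < N) ∧
    ∀ (s : ℕ) (hs : s ≤ d), 1 ≤ s →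
      IsReconstructing (firstCoords hs '' I) (firstCoords hs z) N

/-- The smallest prime that is at least `|D(I)|` and larger than all the coordinates of elements of
`D(I)`; with this lattice size the component-by-component search never gets stuck. -/
def cbcSize {d : ℕ} (I : Set (Fin d → ℤ)) : ℕ :=
  sInf {p : ℕ | p.Prime ∧ (diffSet I).ncard ≤ p ∧ ∀ h ∈ diffSet I, ∀ s, |h s| < (p : ℤ)}

/-- `Λ(z,M)` is a reconstructing rank-1 lattice for `I` constructed by the component-by-component
strategy: the generating vector is found by the component-by-component search with some lattice
size `N ≤ cbcSize I`, after which the lattice size may be decreased to some `M ≤ N` for which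
`Λ(z,M)` is still reconstructing (the choice `M = N` is allowed). -/
def IsCBCLattice {d : ℕ} (I : Set (Fin d → ℤ)) (z : Fin d → ℤ) (M : ℕ) : Prop :=
  IsReconstructing I z M ∧ ∃ N, M ≤ N ∧ N ≤ cbcSize I ∧ IsCBCVector I N z

/-- The bound in terms of the refinement. -/
def refinementRate (d : ℕ) (α β R : ℝ) : ℝ :=
  (2 : ℝ) ^ (-(α + β - 1 / 2) * R) * (if β = 0 then R ^ (((d : ℝ) - 1) / 2) else 1)

/-- The bound in terms of the number of lattice points. -/
def latticeSizeRate (d : ℕ) (α β : ℝ) (M : ℕ) : ℝ :=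
  (M : ℝ) ^ (-(α + β - 1 / 2) / 2) *
    (if β = 0 then Real.log M ^ (((d : ℝ) - 2) / 2 * (α - 1 / 2) + ((d : ℝ) - 1) / 2) else 1)

end

/-! ### Aliasing and reconstruction for rank-1 lattices. -/

section Lattice

variable {d : ℕ}

/-! Upper bound. For a lattice reconstructing on `I`, the sampling operator fixes the exponentials
with frequency in `I` and sends any other exponential to zero or to a single exponential. Hence the
sup-norm error is at most twice the sum of the Fourier coefficients outside `I`
(`norm_sub_latticeSampling_le`), whatever the lattice. Splitting a coefficient against its weight by
an AM-GM inequality (`tsum_mFourierCoeff_le`) reduces everything to the sum of the inverse weights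
outside the hyperbolic cross, which must be of the order of the squared rate
(`tsum_compl_hypCross_le`).

That sum is organised by dyadic blocks. For `β < 0`, sum first over the largest level: the cross is
shaped so that the remaining levels still carry a factor `2 ^ (-δ * m)` with `δ > 0`, and no
logarithm appears. For `β = 0` this decay is lost, and about `R ^ (d - 1)` choices of the remaining
levels contribute equally.

Lattice size. A reconstructing lattice has at least as many nodes as the cross has points, so `2 ^ R
≤ M`. A component-by-component lattice has `M ≤ cbcSize`, which Bertrand's postulate bounds by the
size and the coordinates of the difference set. For `β < 0`, squaring the size of the cross gives `2
^ (2 * R)`. For `β = 0` this would cost too many logarithms; instead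
`encard_diffSet_hypCross_zero_le` divides the coordinates according to which of the two frequencies
has the larger level, and obtains `2 ^ (2 * R) * R ^ (d - 2)`. Substituting these bounds on `M`
gives the second rate (`refinementRate_le_latticeSizeRate`). The search itself succeeds because each
nonzero difference excludes at most one residue modulo a prime (`exists_next_component`). -/

theorem mFourier_latticeNode (k z : Fin d → ℤ) (M j : ℕ) :
    mFourier k (latticeNode z M j)
      = Complex.exp (2 * Real.pi * Complex.I * ((k ⬝ᵥ z : ℤ) : ℂ) / M) ^ j := by
  rw [← Complex.exp_nat_mul]
  simp only [mFourier, latticeNode, ContinuousMap.coe_mk, fourier_coe_apply, ← Complex.exp_sum]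
  congr 1
  simp only [dotProduct, Int.cast_sum, Int.cast_mul, Finset.mul_sum, Finset.sum_div]
  refine Finset.sum_congr rfl fun s _ => ?_
  push_cast
  ring

/-- The rule averages the powers of an `M`-th root of unity; the geometric sum vanishes unless that
root is 1. -/
theorem latticeCoeff_mFourier (k l z : Fin d → ℤ) {M : ℕ} (hM : 0 < M) :
    latticeCoeff z M (mFourier l) k = if (M : ℤ) ∣ (l - k) ⬝ᵥ z then 1 else 0 := by
  have hM' : (M : ℂ) ≠ 0 := by exact_mod_cast hM.ne'
  set ζ := Complex.exp (2 * Real.pi * Complex.I * (((l - k) ⬝ᵥ z : ℤ) : ℂ) / M) with hζ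
  have h1 : latticeCoeff z M (mFourier l) k = (1 / (M : ℂ)) * ∑ j ∈ Finset.range M, ζ ^ j := by
    unfold latticeCoeff
    congr 1
    refine Finset.sum_congr rfl fun j _ => ?_
    rw [← mFourier_add, ← sub_eq_add_neg, mFourier_latticeNode]
  have hpow : ζ ^ M = 1 := by
    rw [hζ, ← Complex.exp_nat_mul, Complex.exp_eq_one_iff]
    exact ⟨(l - k) ⬝ᵥ z, by field_simp⟩
  have hone : ζ = 1 ↔ (M : ℤ) ∣ (l - k) ⬝ᵥ z := by
    rw [hζ, Complex.exp_eq_one_iff]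
    have hpi : (2 * Real.pi * Complex.I : ℂ) ≠ 0 := Complex.two_pi_I_ne_zero
    constructor
    · rintro ⟨n, hn⟩
      refine ⟨n, ?_⟩
      rw [div_eq_iff hM', mul_comm (n : ℂ), mul_assoc _ (n : ℂ)] at hn
      have := mul_left_cancel₀ hpi hn
      rw [mul_comm] at this
      exact_mod_cast this
    · rintro ⟨n, hn⟩
      refine ⟨n, ?_⟩
      rw [hn]
      push_cast
      field_simp
  rw [h1]
  split_ifs with h
  · rw [hone.2 h]
    simp [hM']
  · rw [geom_sum_eq (fun h' => h (hone.1 h')), hpow]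
    simp

theorem latticeSampling_eq_sum {I : Set (Fin d → ℤ)} (hI : I.Finite) (z : Fin d → ℤ) (M : ℕ)
    (g : C(UnitAddTorus (Fin d), ℂ)) :
    latticeSampling I z M g = ∑ k ∈ hI.toFinset, latticeCoeff z M g k • mFourier k := by
  unfold latticeSampling
  exact finsum_mem_eq_finite_toFinset_sum _ hI

/-- The lattice rule as a continuous linear functional. -/
noncomputable def latticeCoeffCLM (z : Fin d → ℤ) (M : ℕ) (k : Fin d → ℤ) :
    C(UnitAddTorus (Fin d), ℂ) →L[ℂ] ℂ :=
  (1 / (M : ℂ)) • ∑ j ∈ Finset.range M,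
    mFourier (-k) (latticeNode z M j) • ContinuousMap.evalCLM ℂ (latticeNode z M j)

theorem latticeCoeffCLM_apply (z : Fin d → ℤ) (M : ℕ) (k : Fin d → ℤ)
    (g : C(UnitAddTorus (Fin d), ℂ)) : latticeCoeffCLM z M k g = latticeCoeff z M g k := by
  simp [latticeCoeffCLM, latticeCoeff, mul_comm]

/-- The sampling operator as a continuous linear map. -/
noncomputable def latticeSamplingCLM {I : Set (Fin d → ℤ)} (hI : I.Finite) (z : Fin d → ℤ)
    (M : ℕ) : C(UnitAddTorus (Fin d), ℂ) →L[ℂ] C(UnitAddTorus (Fin d), ℂ) :=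
  ∑ k ∈ hI.toFinset, (latticeCoeffCLM z M k).smulRight (mFourier k)

theorem latticeSamplingCLM_apply {I : Set (Fin d → ℤ)} (hI : I.Finite) (z : Fin d → ℤ)
    (M : ℕ) (g : C(UnitAddTorus (Fin d), ℂ)) :
    latticeSamplingCLM hI z M g = latticeSampling I z M g := by
  simp [latticeSamplingCLM, latticeSampling_eq_sum hI, latticeCoeffCLM_apply]

theorem latticeSampling_mFourier {I : Set (Fin d → ℤ)} (hI : I.Finite) (z l : Fin d → ℤ)
    {M : ℕ} (hM : 0 < M) :
    latticeSampling I z M (mFourier l)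
      = ∑ k ∈ hI.toFinset with (M : ℤ) ∣ (l - k) ⬝ᵥ z, mFourier k := by
  rw [latticeSampling_eq_sum hI, Finset.sum_filter]
  refine Finset.sum_congr rfl fun k _ => ?_
  rw [latticeCoeff_mFourier _ _ _ hM]
  split_ifs
  · exact one_smul ℂ (mFourier k : C(UnitAddTorus (Fin d), ℂ))
  · exact zero_smul ℂ (mFourier k : C(UnitAddTorus (Fin d), ℂ))

/-- A rank-1 lattice is reconstructing for `I` iff the numbers `k·z`, `k ∈ I`, are distinct
modulo `M`. -/
theorem isReconstructing_iff {I : Set (Fin d → ℤ)} (hI : I.Finite) (z : Fin d → ℤ) (M : ℕ) :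
    IsReconstructing I z M ↔
      0 < M ∧ ∀ k ∈ I, ∀ l ∈ I, (M : ℤ) ∣ (k - l) ⬝ᵥ z → k = l := by
  refine and_congr_right fun hM => ⟨fun h k hk l hl hkl => ?_, fun h p hp => ?_⟩
  · have h1 := h (mFourier k) (Submodule.subset_span ⟨k, hk, rfl⟩)
    rw [latticeSampling_mFourier hI z k hM] at h1
    -- At the origin all exponentials equal 1, so the identity counts the frequencies of `I` aliased
    -- with `k`.
    have h2 := congrArg (fun g : C(UnitAddTorus (Fin d), ℂ) => g 0) h1
    simp only [ContinuousMap.coe_sum, Finset.sum_apply] at h2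
    have h3 : ∀ n : Fin d → ℤ, mFourier n (0 : UnitAddTorus (Fin d)) = 1 := fun n => by
      simp [mFourier]
    simp only [h3, Finset.sum_const, nsmul_eq_mul, mul_one] at h2
    have h4 : (hI.toFinset.filter fun k' => (M : ℤ) ∣ (k - k') ⬝ᵥ z).card = 1 := by
      exact_mod_cast h2
    exact Finset.card_le_one.1 h4.le k (by simp [hk]) l
      (by simpa only [Finset.mem_filter, Set.Finite.mem_toFinset] using ⟨hl, hkl⟩)
  · rw [← latticeSamplingCLM_apply hI]
    induction hp using Submodule.span_induction with
    | mem x hx =>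
      obtain ⟨k, hk, rfl⟩ := hx
      dsimp only
      rw [latticeSamplingCLM_apply, latticeSampling_mFourier hI z k hM]
      have : (hI.toFinset.filter fun k' => (M : ℤ) ∣ (k - k') ⬝ᵥ z) = {k} := by
        ext l
        simp only [Finset.mem_filter, Set.Finite.mem_toFinset, Finset.mem_singleton]
        exact ⟨fun hl => (h k hk l hl.1 hl.2).symm, fun hl => by simp [hl, hk]⟩
      rw [this, Finset.sum_singleton]
    | zero => simp
    | add x y _ _ hx hy => rw [map_add, hx, hy]
    | smul a x _ hx => rw [map_smul, hx]

/-- Two frequencies of `I` aliased with `l` are aliased with each other, hence equal, so at most one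
exponential survives. -/
theorem norm_latticeSampling_mFourier_le {I : Set (Fin d → ℤ)} (hI : I.Finite)
    {z : Fin d → ℤ} {M : ℕ} (h : IsReconstructing I z M) (l : Fin d → ℤ) :
    ‖latticeSampling I z M (mFourier l)‖ ≤ 1 := by
  obtain ⟨hM, hinj⟩ := (isReconstructing_iff hI z M).1 h
  rw [latticeSampling_mFourier hI z l hM]
  refine (norm_sum_le _ _).trans ?_
  simp only [mFourier_norm, Finset.sum_const, nsmul_eq_mul, mul_one]
  norm_cast
  refine Finset.card_le_one.2 fun a ha b hb => ?_
  simp only [Finset.mem_filter, Set.Finite.mem_toFinset] at ha hb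
  refine hinj a ha.1 b hb.1 ?_
  have := dvd_sub hb.2 ha.2
  rwa [← sub_dotProduct, sub_sub_sub_cancel_left] at this

theorem IsReconstructing.ncard_le {I : Set (Fin d → ℤ)} (hI : I.Finite)
    {z : Fin d → ℤ} {M : ℕ} (h : IsReconstructing I z M) : I.ncard ≤ M := by
  obtain ⟨hM, hinj⟩ := (isReconstructing_iff hI z M).1 h
  have : NeZero M := ⟨hM.ne'⟩
  have h1 : Set.InjOn (fun k : Fin d → ℤ => ((k ⬝ᵥ z : ℤ) : ZMod M)) I := by
    intro k hk l hl hkl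
    refine hinj k hk l hl ?_
    rw [sub_dotProduct]
    exact (ZMod.intCast_eq_intCast_iff_dvd_sub _ _ _).1 hkl.symm
  have h2 := Set.ncard_le_ncard_of_injOn (t := Set.univ) _ (fun _ _ => Set.mem_univ _) h1
  simpa [Set.ncard_univ, Nat.card_zmod] using h2

/-- The aliasing error of a reconstructing lattice is at most the truncation error. -/
theorem norm_sub_latticeSampling_le {I : Set (Fin d → ℤ)} (hI : I.Finite)
    {z : Fin d → ℤ} {M : ℕ} (h : IsReconstructing I z M) {g : C(UnitAddTorus (Fin d), ℂ)}
    (hg : Summable (mFourierCoeff g)) :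
    ‖g - latticeSampling I z M g‖ ≤ 2 * ∑' k : ↥Iᶜ, ‖mFourierCoeff g k‖ := by
  have h1 := hasSum_mFourier_series_of_summable hg
  have h2 := (latticeSamplingCLM hI z M).hasSum h1
  have h3 := h1.sub h2
  rw [latticeSamplingCLM_apply] at h3
  have h4 : HasSum (Iᶜ.indicator fun k => ‖mFourierCoeff g k‖)
      (∑' k : ↥Iᶜ, ‖mFourierCoeff g k‖) := by
    rw [← hasSum_subtype_iff_indicator]
    exact (hg.norm.subtype _).hasSum
  rw [← h3.tsum_eq]
  refine tsum_of_norm_bounded (h4.mul_left 2) fun k => ?_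
  rw [map_smul, latticeSamplingCLM_apply]
  refine (congrArg norm (smul_sub (mFourierCoeff g k) (mFourier k) _)).symm.trans_le ?_
  rw [norm_smul]
  by_cases hk : k ∈ I
  · rw [h.2 _ (Submodule.subset_span ⟨k, hk, rfl⟩)]
    simp [hk]
  · rw [Set.indicator_of_mem (show k ∈ Iᶜ from hk), mul_comm]
    gcongr
    refine (norm_sub_le _ _).trans ?_
    rw [mFourier_norm]
    linarith [norm_latticeSampling_mFourier_le hI h k]

end Lattice

/-! ### From weighted coefficient sums to the sampling error. -/

section HybridSpace

variable {d : ℕ}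

/-- The weight `(1+‖k‖₂²)^β ∏_s (1+|k_s|²)^α` of hybrid mixed smoothness. -/
noncomputable def hybridWeight (α β : ℝ) (k : Fin d → ℤ) : ℝ :=
  (1 + ∑ s, (k s : ℝ) ^ 2) ^ β * ∏ s, (1 + (k s : ℝ) ^ 2) ^ α

theorem hybridWeight_pos (α β : ℝ) (k : Fin d → ℤ) : 0 < hybridWeight α β k := by
  unfold hybridWeight
  have h : 0 ≤ ∑ s, (k s : ℝ) ^ 2 := Finset.sum_nonneg fun s _ => sq_nonneg _
  refine mul_pos (Real.rpow_pos_of_pos (by linarith) _) (Finset.prod_pos fun s _ => ?_)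
  exact Real.rpow_pos_of_pos (by positivity) _

/-- The square of the hybrid norm. -/
noncomputable def hybridEnergy (α β : ℝ) (f : Lp ℂ 2 (torusMeasure d)) : ℝ≥0∞ :=
  ∑' k : Fin d → ℤ, ENNReal.ofReal
    (‖mFourierCoeff (f : UnitAddTorus (Fin d) → ℂ) k‖ ^ 2 * hybridWeight α β k)

theorem hybridNorm_eq (α β : ℝ) (f : Lp ℂ 2 (torusMeasure d)) :
    hybridNorm α β f = hybridEnergy α β f ^ (1 / 2 : ℝ) := by
  simp only [hybridNorm, hybridEnergy, hybridWeight, mul_assoc]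

/-- A termwise substitute for Cauchy-Schwarz, `a ≤ r * a ^ 2 * w + (r * w)⁻¹`, which needs no
summability; `r` is tuned later. -/
theorem tsum_mFourierCoeff_le (α β : ℝ) (f : Lp ℂ 2 (torusMeasure d)) (I : Set (Fin d → ℤ))
    {r : ℝ} (hr : 0 < r) :
    ∑' k : I, ENNReal.ofReal ‖mFourierCoeff (f : UnitAddTorus (Fin d) → ℂ) k‖
      ≤ ENNReal.ofReal r * hybridEnergy α β f
        + ENNReal.ofReal r⁻¹ * ∑' k : I, ENNReal.ofReal (hybridWeight α β k.1)⁻¹ := by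
  have h1 : ∑' k : I, ENNReal.ofReal
      (‖mFourierCoeff (f : UnitAddTorus (Fin d) → ℂ) k‖ ^ 2 * hybridWeight α β k.1)
      ≤ hybridEnergy α β f :=
    ENNReal.tsum_comp_le_tsum_of_injective Subtype.val_injective
      (fun k => ENNReal.ofReal
        (‖mFourierCoeff (f : UnitAddTorus (Fin d) → ℂ) k‖ ^ 2 * hybridWeight α β k))
  refine le_trans ?_ (add_le_add_left (mul_le_mul_right h1 _) _)
  rw [← ENNReal.tsum_mul_left, ← ENNReal.tsum_mul_left, ← ENNReal.tsum_add]
  refine ENNReal.tsum_le_tsum fun k => ?_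
  have hw := hybridWeight_pos α β k.1
  set w := hybridWeight α β k.1
  set a := ‖mFourierCoeff (f : UnitAddTorus (Fin d) → ℂ) k‖
  rw [← ENNReal.ofReal_mul hr.le, ← ENNReal.ofReal_mul (by positivity),
    ← ENNReal.ofReal_add (by positivity) (by positivity)]
  refine ENNReal.ofReal_le_ofReal ?_
  rw [← mul_inv, ← sub_nonneg]
  have hx : 0 < r * w := by positivity
  have : r * (a ^ 2 * w) + (r * w)⁻¹ - a
      = (r * w)⁻¹ * ((a * (r * w) - 1 / 2) ^ 2 + 3 / 4) := by
    field_simp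
    ring
  rw [this]
  positivity

theorem summable_mFourierCoeff {α β : ℝ} {f : Lp ℂ 2 (torusMeasure d)}
    (hf : hybridEnergy α β f < ∞)
    (hW : ∑' k : Fin d → ℤ, ENNReal.ofReal (hybridWeight α β k)⁻¹ ≠ ∞) :
    Summable (mFourierCoeff (f : UnitAddTorus (Fin d) → ℂ)) := by
  have h1 := tsum_mFourierCoeff_le α β f Set.univ one_pos
  rw [tsum_univ (fun k : Fin d → ℤ => ENNReal.ofReal ‖mFourierCoeff (f : UnitAddTorus (Fin d) → ℂ) k‖),
    tsum_univ (fun k : Fin d → ℤ => ENNReal.ofReal (hybridWeight α β k)⁻¹)] at h1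
  have h2 : ∑' k : Fin d → ℤ,
      ENNReal.ofReal ‖mFourierCoeff (f : UnitAddTorus (Fin d) → ℂ) k‖ ≠ ∞ := by
    refine ne_top_of_le_ne_top ?_ h1
    simp [hW, hf.ne]
  refine Summable.of_norm ?_
  have h3 := ENNReal.summable_toReal h2
  simpa [ENNReal.toReal_ofReal] using h3

/-- The Fourier series converges uniformly, and the image of its sum in `L²` is the `L²` Fourier
series of `f`. -/
theorem exists_isContRep {f : Lp ℂ 2 (torusMeasure d)}
    (hf : Summable (mFourierCoeff (f : UnitAddTorus (Fin d) → ℂ))) : ∃ g, IsContRep f g := by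
  have h1 : Summable fun k : Fin d → ℤ =>
      mFourierCoeff (f : UnitAddTorus (Fin d) → ℂ) k • (mFourier k : C(UnitAddTorus (Fin d), ℂ)) := by
    refine Summable.of_norm ?_
    simpa only [norm_smul, mFourier_norm, mul_one] using hf.norm
  have h2 := (ContinuousMap.toLp (E := ℂ) 2 (torusMeasure d) ℂ).hasSum h1.hasSum
  have h3 : HasSum (fun k : Fin d → ℤ => mFourierCoeff (f : UnitAddTorus (Fin d) → ℂ) k •
      ContinuousMap.toLp (E := ℂ) 2 (torusMeasure d) ℂ (mFourier k)) f :=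
    hasSum_mFourier_series_L2 f
  simp only [map_smul] at h2
  have h4 := h2.unique h3
  have h5 := ContinuousMap.coeFn_toLp (p := 2) (𝕜 := ℂ) (torusMeasure d) (∑' k : Fin d → ℤ,
    mFourierCoeff (f : UnitAddTorus (Fin d) → ℂ) k • (mFourier k : C(UnitAddTorus (Fin d), ℂ)))
  rw [h4] at h5
  exact ⟨_, h5⟩

theorem isContRep_contRep {f : Lp ℂ 2 (torusMeasure d)} (h : ∃ g, IsContRep f g) :
    IsContRep f (contRep f) := by
  unfold contRep
  rw [dif_pos h]
  exact h.choose_spec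

theorem IsContRep.mFourierCoeff_eq {f : Lp ℂ 2 (torusMeasure d)} {g : C(UnitAddTorus (Fin d), ℂ)}
    (h : IsContRep f g) :
    mFourierCoeff g = mFourierCoeff (f : UnitAddTorus (Fin d) → ℂ) := by
  funext k
  refine integral_congr_ae ?_
  have h' : (f : UnitAddTorus (Fin d) → ℂ) =ᵐ[torusMeasure d] g := h
  filter_upwards [h'] with x hx
  rw [hx]

/-- With energy at most 1 and inverse-weight tail at most `r ^ 2`, both AM-GM terms are at most `r`;
aliasing doubles `2 * r` to `4 * r`. -/
theorem samplingError_le {α β : ℝ} {I : Set (Fin d → ℤ)} (hI : I.Finite)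
    {z : Fin d → ℤ} {M : ℕ} (h : IsReconstructing I z M)
    (hW : ∑' k : Fin d → ℤ, ENNReal.ofReal (hybridWeight α β k)⁻¹ ≠ ∞) {r : ℝ} (hr : 0 < r)
    (hIr : ∑' k : ↥Iᶜ, ENNReal.ofReal (hybridWeight α β k.1)⁻¹ ≤ ENNReal.ofReal (r ^ 2)) :
    samplingError α β I z M ≤ ENNReal.ofReal (4 * r) := by
  refine iSup₂_le fun f hf => ?_
  have hE : hybridEnergy α β f ≤ 1 := by
    rw [hybridNorm_eq] at hf
    by_contra! hlt
    exact absurd hf (not_le.2 (ENNReal.one_lt_rpow hlt (by norm_num)))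
  have hs := summable_mFourierCoeff (hE.trans_lt ENNReal.one_lt_top) hW
  have hg := isContRep_contRep (exists_isContRep hs)
  set g := contRep f
  have hsg : Summable (mFourierCoeff g) := by rwa [hg.mFourierCoeff_eq]
  have h1 : (fun x => f x - latticeSampling I z M g x) =ᵐ[torusMeasure d]
      ⇑(g - latticeSampling I z M g) := by
    have hg' : (f : UnitAddTorus (Fin d) → ℂ) =ᵐ[torusMeasure d] g := hg
    filter_upwards [hg'] with x hx
    simp [hx]
  rw [eLpNorm_congr_ae h1]
  have h2 := norm_sub_latticeSampling_le hI h hsg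
  have h3 : ENNReal.ofReal (∑' k : ↥Iᶜ, ‖mFourierCoeff g k‖) ≤ ENNReal.ofReal (2 * r) := by
    rw [ENNReal.ofReal_tsum_of_nonneg (fun _ => norm_nonneg _) (hsg.norm.subtype _),
      hg.mFourierCoeff_eq]
    refine (tsum_mFourierCoeff_le α β f Iᶜ hr).trans ?_
    calc _ ≤ ENNReal.ofReal r * 1 + ENNReal.ofReal r⁻¹ * ENNReal.ofReal (r ^ 2) := by gcongr
      _ = ENNReal.ofReal (2 * r) := by
        rw [mul_one, ← ENNReal.ofReal_mul (by positivity),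
          ← ENNReal.ofReal_add hr.le (by positivity)]
        congr 1
        field_simp
        ring
  have h4 := (ENNReal.ofReal_le_ofReal_iff (by positivity)).1 h3
  rw [eLpNorm_exponent_top]
  refine eLpNormEssSup_le_of_ae_bound (Filter.Eventually.of_forall fun x => ?_)
  exact ((g - latticeSampling I z M g).norm_coe_le_norm x).trans (by linarith)

end HybridSpace

/-! ### Dyadic levels and geometric sums over them. -/

section Levels

/-- The index of the dyadic block that contains `k`. -/
def dyadicLevel (k : ℤ) : ℕ := Nat.clog 2 k.natAbs

theorem dyadicLevel_le_iff (k : ℤ) (n : ℕ) : dyadicLevel k ≤ n ↔ k.natAbs ≤ 2 ^ n :=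
  Nat.clog_le_iff_le_pow one_lt_two

/-- The blocks are thus the fibres of a function, so they partition `ℤ` and membership in the cross
becomes a condition on levels. -/
theorem mem_dyadicBlock_iff (k : ℤ) (j : ℕ) : k ∈ dyadicBlock j ↔ dyadicLevel k = j := by
  rcases j with _ | j
  · rw [← Nat.le_zero, dyadicLevel_le_iff]
    simp only [dyadicBlock, if_true, Set.mem_insert_iff, Set.mem_singleton_iff, pow_zero]
    omega
  · have h1 : dyadicLevel k = j + 1 ↔ dyadicLevel k ≤ j + 1 ∧ ¬ dyadicLevel k ≤ j := by omega
    rw [h1, dyadicLevel_le_iff, dyadicLevel_le_iff]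
    simp only [dyadicBlock, Nat.add_eq_zero_iff, one_ne_zero, and_false, if_false, Set.mem_union,
      Set.mem_Icc, Nat.add_sub_cancel]
    zify
    generalize hA : (2 : ℤ) ^ (j + 1) = A
    generalize hB : (2 : ℤ) ^ j = B
    have hB0 : 0 < B := by rw [← hB]; positivity
    rcases abs_cases k with h | h <;> omega

theorem mem_hypCross_iff {d : ℕ} (T R : ℝ) (k : Fin d → ℤ) :
    k ∈ hypCross d T R ↔ (fun s => dyadicLevel (k s)) ∈ hypCrossLevels d T R := by
  simp only [hypCross, Set.mem_iUnion, Set.mem_univ_pi, mem_dyadicBlock_iff, exists_prop]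
  constructor
  · rintro ⟨j, hj, h⟩
    rwa [show (fun s => dyadicLevel (k s)) = j from funext h]
  · intro h
    exact ⟨_, h, fun _ => rfl⟩

/-- A sum over `ℤ^d` of a function of the dyadic levels. -/
theorem tsum_dyadicLevel_le {d : ℕ} (G : (Fin d → ℕ) → ℝ≥0∞) :
    ∑' k : Fin d → ℤ, G (fun s => dyadicLevel (k s))
      ≤ 3 ^ d * ∑' j : Fin d → ℕ, (∏ s, (2 : ℝ≥0∞) ^ (j s : ℝ)) * G j := by
  rw [← (Equiv.sigmaFiberEquiv fun (k : Fin d → ℤ) s => dyadicLevel (k s)).tsum_eq,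
    ENNReal.tsum_sigma', ← ENNReal.tsum_mul_left]
  refine ENNReal.tsum_le_tsum fun j => ?_
  have h1 : ∀ x : {k : Fin d → ℤ // (fun s => dyadicLevel (k s)) = j},
      G (fun s => dyadicLevel (Equiv.sigmaFiberEquiv
        (fun (k : Fin d → ℤ) s => dyadicLevel (k s)) ⟨j, x⟩ s)) = G j := fun x =>
    congrArg G x.2
  simp only [h1, ENNReal.tsum_const]
  rw [← mul_assoc]
  gcongr
  -- The block is enclosed in a full box, whose sides have `2 * 2 ^ j s + 1 ≤ 3 * 2 ^ j s` points.
  have h2 : {k : Fin d → ℤ | (fun s => dyadicLevel (k s)) = j}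
      ⊆ ↑(Fintype.piFinset fun s => Finset.Icc (-(2 : ℤ) ^ j s) (2 ^ j s)) := by
    intro k hk
    simp only [Finset.mem_coe, Fintype.mem_piFinset, Finset.mem_Icc]
    intro s
    have h3 := (dyadicLevel_le_iff (k s) (j s)).1 (congrFun hk s).le
    zify at h3
    exact abs_le.1 h3
  have h3 := Set.encard_le_encard h2
  rw [Set.encard_coe_eq_coe_finsetCard, Fintype.card_piFinset] at h3
  have h4 : ENat.card {k : Fin d → ℤ // (fun s => dyadicLevel (k s)) = j}
      ≤ ((∏ s, 3 * 2 ^ j s : ℕ) : ℕ∞) := by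
    refine h3.trans ?_
    norm_cast
    refine Finset.prod_le_prod' fun s _ => ?_
    rw [Int.card_Icc]
    zify
    have h5 : (0 : ℤ) < 2 ^ j s := by positivity
    rw [Int.toNat_of_nonneg (by linarith)]
    linarith
  calc ((ENat.card {k : Fin d → ℤ // (fun s => dyadicLevel (k s)) = j} : ℕ∞) : ℝ≥0∞)
      ≤ (((∏ s, 3 * 2 ^ j s : ℕ) : ℕ∞) : ℝ≥0∞) := ENat.toENNReal_mono h4
    _ = 3 ^ d * ∏ s, (2 : ℝ≥0∞) ^ (j s : ℝ) := by
      rw [ENat.toENNReal_coe]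
      push_cast
      simp [Finset.prod_mul_distrib]

theorem tsum_fin_pi_prod (f : ℕ → ℝ≥0∞) (n : ℕ) :
    ∑' b : Fin n → ℕ, ∏ s, f (b s) = (∑' m, f m) ^ n := by
  induction n with
  | zero => simp
  | succ n ih =>
    rw [← (Fin.consEquiv fun _ => ℕ).tsum_eq, ENNReal.tsum_prod', pow_succ', ← ih,
      ← ENNReal.tsum_mul_right]
    refine tsum_congr fun m => ?_
    rw [← ENNReal.tsum_mul_left]
    refine tsum_congr fun b => ?_
    simp [Fin.consEquiv, Fin.prod_univ_succ]

theorem tsum_pi_prod {ι : Type*} [Fintype ι] (f : ℕ → ℝ≥0∞) :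
    ∑' b : ι → ℕ, ∏ s, f (b s) = (∑' m, f m) ^ Fintype.card ι := by
  rw [← tsum_fin_pi_prod, ← ((Fintype.equivFin ι).arrowCongr (Equiv.refl ℕ)).tsum_eq]
  refine tsum_congr fun b => ?_
  rw [← (Fintype.equivFin ι).prod_comp]
  simp [Equiv.arrowCongr]

theorem two_rpow_add (x y : ℝ) : (2 : ℝ≥0∞) ^ (x + y) = 2 ^ x * 2 ^ y :=
  ENNReal.rpow_add _ _ (by simp) (by simp)

theorem two_rpow_mono {x y : ℝ} (h : x ≤ y) : (2 : ℝ≥0∞) ^ x ≤ 2 ^ y :=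
  ENNReal.rpow_le_rpow_of_exponent_le (by norm_num) h

theorem two_rpow_ne_top (x : ℝ) : (2 : ℝ≥0∞) ^ x ≠ ∞ :=
  ENNReal.rpow_ne_top_of_ne_zero (by simp) (by simp)

theorem two_rpow_sum {ι : Type*} (t : Finset ι) (x : ι → ℝ) :
    (2 : ℝ≥0∞) ^ (∑ s ∈ t, x s) = ∏ s ∈ t, 2 ^ x s := by
  classical
  induction t using Finset.induction_on with
  | empty => simp
  | insert a t ha ih => rw [Finset.sum_insert ha, Finset.prod_insert ha, two_rpow_add, ih]

theorem tsum_two_rpow_ne_top {c : ℝ} (hc : 0 < c) : ∑' m : ℕ, (2 : ℝ≥0∞) ^ (-c * m) ≠ ∞ := by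
  simp only [ENNReal.rpow_mul, ENNReal.rpow_natCast, ENNReal.tsum_geometric]
  rw [Ne, ENNReal.inv_eq_top, tsub_eq_zero_iff_le, not_le]
  exact ENNReal.rpow_lt_one_of_one_lt_of_neg (by norm_num) (by linarith)

open Classical in
/-- Tails of geometric series. -/
theorem tsum_two_rpow_tail_le (c x : ℝ) (hc : 0 < c) :
    ∑' m : ℕ, (if x ≤ m then (2 : ℝ≥0∞) ^ (-c * m) else 0)
      ≤ (∑' m : ℕ, (2 : ℝ≥0∞) ^ (-c * m)) * 2 ^ (-c * x) := by
  rw [← Summable.sum_add_tsum_nat_add' (k := ⌈x⌉₊) ENNReal.summable, Finset.sum_eq_zero, zero_add,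
    ← ENNReal.tsum_mul_right]
  · refine ENNReal.tsum_le_tsum fun m => ?_
    split_ifs with h
    · rw [← two_rpow_add]
      refine two_rpow_mono ?_
      push_cast
      nlinarith [Nat.le_ceil x]
    · exact zero_le
  · intro m hm
    rw [if_neg]
    exact not_le.2 (Nat.lt_ceil.1 (Finset.mem_range.1 hm))

open Classical in
theorem tsum_two_rpow_head_le (x : ℝ) :
    ∑' m : ℕ, (if (m : ℝ) ≤ x then (2 : ℝ≥0∞) ^ (m : ℝ) else 0) ≤ 2 * 2 ^ x := by
  rcases lt_or_ge x 0 with hx | hx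
  · have : ∀ m : ℕ, ¬ (m : ℝ) ≤ x := fun m hm => by
      have : (0 : ℝ) ≤ m := Nat.cast_nonneg m
      linarith
    simp [this]
  · have hsum : ∀ n : ℕ, ∑ m ∈ Finset.range n, (2 : ℝ≥0∞) ^ (m : ℝ) ≤ 2 ^ (n : ℝ) := by
      intro n
      induction n with
      | zero => simp
      | succ n ih =>
        rw [Finset.sum_range_succ]
        push_cast
        rw [two_rpow_add, ENNReal.rpow_one, mul_two]
        gcongr
    rw [tsum_eq_sum (s := Finset.range (⌊x⌋₊ + 1))]
    · refine (Finset.sum_le_sum fun m _ => ?_).trans ((hsum _).trans ?_)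
      · split_ifs
        · exact le_rfl
        · exact zero_le
      · push_cast
        rw [two_rpow_add, ENNReal.rpow_one, mul_comm]
        gcongr
        · norm_num
        · exact Nat.floor_le hx
    · intro m hm
      rw [if_neg]
      intro h
      exact hm (Finset.mem_range.2 (Nat.lt_succ_of_le (Nat.le_floor h)))

/-- Splitting off one coordinate in a sum over `ι → ℕ`. -/
theorem tsum_funSplitAt {ι : Type*} [Fintype ι] [DecidableEq ι] (i : ι)
    (F : ℕ → ({j // j ≠ i} → ℕ) → ℝ≥0∞) :
    ∑' j : ι → ℕ, F (j i) (fun s => j s) = ∑' (b : {j // j ≠ i} → ℕ) (m : ℕ), F m b := by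
  rw [ENNReal.tsum_comm, ← ENNReal.tsum_prod, ← (Equiv.funSplitAt i ℕ).tsum_eq]
  rfl

theorem sum_funSplitAt {ι : Type*} [Fintype ι] [DecidableEq ι] (i : ι) (j : ι → ℝ) :
    ∑ s, j s = j i + ∑ s : {s // s ≠ i}, j s := by
  rw [Fintype.sum_eq_add_sum_subtype_ne]

end Levels

/-! ### The level sum outside the hyperbolic cross. -/

section TailSums

variable {d : ℕ}

/-- Level `n + 1` forces `2 ^ n < |k|`; at level 0 the left side is below 1. -/
theorem two_rpow_dyadicLevel_le (k : ℤ) :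
    (2 : ℝ) ^ (2 * (dyadicLevel k : ℝ) - 2) ≤ 1 + (k : ℝ) ^ 2 := by
  rcases Nat.eq_zero_or_pos (dyadicLevel k) with h | h
  · rw [h]
    have : (2 : ℝ) ^ (2 * ((0 : ℕ) : ℝ) - 2) ≤ 1 :=
      Real.rpow_le_one_of_one_le_of_nonpos (by norm_num) (by norm_num)
    nlinarith [sq_nonneg (k : ℝ)]
  · obtain ⟨n, hn⟩ := Nat.exists_eq_succ_of_ne_zero h.ne'
    have h1 : ¬ dyadicLevel k ≤ n := by omega
    rw [dyadicLevel_le_iff, not_le] at h1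
    have h2 : (2 : ℝ) ^ n ≤ |(k : ℝ)| := by
      rw [← Int.cast_abs, Int.abs_eq_natAbs]
      exact_mod_cast h1.le
    have h3 : (2 : ℝ) ^ (2 * (dyadicLevel k : ℝ) - 2) = ((2 : ℝ) ^ n) ^ 2 := by
      rw [hn, ← pow_mul, ← Real.rpow_natCast]
      congr 1
      push_cast
      ring
    rw [h3, ← sq_abs (k : ℝ)]
    have : ((2 : ℝ) ^ n) ^ 2 ≤ |(k : ℝ)| ^ 2 := by gcongr
    linarith

theorem abs_le_two_rpow_dyadicLevel (k : ℤ) : |(k : ℝ)| ≤ 2 ^ (dyadicLevel k : ℝ) := by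
  have h := (dyadicLevel_le_iff k _).1 le_rfl
  rw [← Int.cast_abs, Int.abs_eq_natAbs, Real.rpow_natCast]
  exact_mod_cast h

/-- The weight on the dyadic block with index `j`, up to constants. -/
theorem inv_hybridWeight_le {α β : ℝ} (hα : 0 ≤ α) (hβ : β ≤ 0) (k : Fin d → ℤ) :
    (hybridWeight α β k)⁻¹ ≤ (1 + d) ^ (-β) * 2 ^ (2 * α * d) *
      2 ^ (-2 * α * (∑ s, (dyadicLevel (k s) : ℝ))
        - 2 * β * ((Finset.univ.sup fun s => dyadicLevel (k s) : ℕ) : ℝ)) := by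
  set m := Finset.univ.sup fun s => dyadicLevel (k s) with hm
  have h2 : (0 : ℝ) < 2 := two_pos
  have hS : 0 ≤ ∑ s, (k s : ℝ) ^ 2 := Finset.sum_nonneg fun s _ => sq_nonneg _
  have hsum : 1 + ∑ s, (k s : ℝ) ^ 2 ≤ (1 + d) * 2 ^ (2 * (m : ℝ)) := by
    have h3 : ∀ s, (k s : ℝ) ^ 2 ≤ 2 ^ (2 * (m : ℝ)) := by
      intro s
      rw [← sq_abs, mul_comm, Real.rpow_mul h2.le]
      norm_cast
      have h4 := abs_le_two_rpow_dyadicLevel (k s)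
      rw [Real.rpow_natCast] at h4
      have h5 : dyadicLevel (k s) ≤ m := by
        rw [hm]
        exact Finset.le_sup (f := fun s => dyadicLevel (k s)) (Finset.mem_univ s)
      have h6 : |(k s : ℝ)| ^ 2 ≤ (2 ^ m) ^ 2 :=
        pow_le_pow_left₀ (abs_nonneg _) (h4.trans (pow_le_pow_right₀ one_le_two h5)) 2
      exact_mod_cast h6
    have h4 : ∑ s, (k s : ℝ) ^ 2 ≤ ∑ _s : Fin d, (2 : ℝ) ^ (2 * (m : ℝ)) :=
      Finset.sum_le_sum fun s _ => h3 s
    have h5 : (1 : ℝ) ≤ 2 ^ (2 * (m : ℝ)) := Real.one_le_rpow one_le_two (by positivity)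
    simp only [Finset.sum_const, Finset.card_univ, Fintype.card_fin, nsmul_eq_mul] at h4
    linarith
  unfold hybridWeight
  rw [mul_inv, ← Real.rpow_neg (by linarith), ← Finset.prod_inv_distrib]
  have hA : (1 + ∑ s, (k s : ℝ) ^ 2) ^ (-β) ≤ (1 + d) ^ (-β) * 2 ^ (-2 * β * (m : ℝ)) := by
    calc _ ≤ ((1 + d) * (2 : ℝ) ^ (2 * (m : ℝ))) ^ (-β) :=
          Real.rpow_le_rpow (by linarith) hsum (by linarith)
      _ = _ := by
        rw [Real.mul_rpow (by positivity) (by positivity), ← Real.rpow_mul h2.le]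
        ring_nf
  have hB : ∏ s, ((1 + (k s : ℝ) ^ 2) ^ α)⁻¹
      ≤ 2 ^ (2 * α * d) * 2 ^ (-2 * α * (∑ s, (dyadicLevel (k s) : ℝ))) := by
    calc ∏ s, ((1 + (k s : ℝ) ^ 2) ^ α)⁻¹
        ≤ ∏ s, (2 : ℝ) ^ (2 * α - 2 * α * (dyadicLevel (k s) : ℝ)) := by
          refine Finset.prod_le_prod (fun s _ => by positivity) fun s _ => ?_
          rw [show 2 * α - 2 * α * (dyadicLevel (k s) : ℝ)
            = -((2 * (dyadicLevel (k s) : ℝ) - 2) * α) by ring, Real.rpow_neg h2.le,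
            Real.rpow_mul h2.le]
          gcongr
          exact two_rpow_dyadicLevel_le _
      _ = _ := by
        rw [← Real.rpow_sum_of_pos h2, ← Real.rpow_add h2, Finset.sum_sub_distrib]
        simp only [Finset.sum_const, Finset.card_univ, Fintype.card_fin, nsmul_eq_mul,
          Finset.mul_sum, neg_mul, Finset.sum_neg_distrib]
        ring_nf
  calc _ ≤ ((1 + d) ^ (-β) * 2 ^ (-2 * β * (m : ℝ)))
        * ((2 : ℝ) ^ (2 * α * d) * 2 ^ (-2 * α * (∑ s, (dyadicLevel (k s) : ℝ)))) :=
        mul_le_mul hA hB (Finset.prod_nonneg fun s _ => by positivity) (by positivity)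
    _ = _ := by
      rw [sub_eq_add_neg (-2 * α * (∑ s, (dyadicLevel (k s) : ℝ))), Real.rpow_add h2]
      ring_nf

open Classical in
/-- The sum over the dyadic blocks outside the hyperbolic cross. -/
noncomputable def levelTail (d : ℕ) (α β R : ℝ) : ℝ≥0∞ :=
  ∑' j : Fin d → ℕ, if j ∈ hypCrossLevels d (-β / α) R then 0 else
    (2 : ℝ≥0∞) ^ ((1 - 2 * α) * (∑ s, (j s : ℝ)) - 2 * β * ((Finset.univ.sup j : ℕ) : ℝ))

theorem tsum_two_rpow_sum_le {ι : Type*} [Fintype ι] (δ : ℝ) :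
    ∑' b : ι → ℕ, (2 : ℝ≥0∞) ^ (-δ * ∑ s, (b s : ℝ))
      = (∑' m : ℕ, (2 : ℝ≥0∞) ^ (-δ * m)) ^ Fintype.card ι := by
  rw [← tsum_pi_prod]
  simp only [Finset.mul_sum, two_rpow_sum]

theorem exists_sup_eq (hd : 1 ≤ d) (j : Fin d → ℕ) : ∃ i, Finset.univ.sup j = j i := by
  obtain ⟨i, _, hi⟩ := Finset.exists_mem_eq_sup Finset.univ
    ⟨(⟨0, hd⟩ : Fin d), Finset.mem_univ _⟩ j
  exact ⟨i, hi⟩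

open Classical in
-- Let `m` be the largest level and `B` the sum of the others. Outside the cross `m` exceeds `R - B
-- * α / (α + β)`, and the term is `2 ^ (-c * m + (1 - 2 * α) * B)`. Summing over `m` gives `2 ^ (-c
-- * R)` times `2 ^ (-δ * B)`, because `c * α / (α + β) + 1 - 2 * α = -δ`.
theorem levelTail_le_of_neg (hd : 1 ≤ d) {α β : ℝ} (hβ : β < 0)
    (hαβ : 1 / 2 < α + β) : ∃ K : ℝ≥0∞, K ≠ ∞ ∧ ∀ R : ℝ,
      levelTail d α β R ≤ K * 2 ^ (-(2 * (α + β) - 1) * R) := by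
  set c := 2 * (α + β) - 1 with hc
  set δ := -β / (α + β) with hδ
  have hc0 : 0 < c := by linarith
  have hab : 0 < α + β := by linarith
  have hα : 0 < α := by linarith
  have hδ0 : 0 < δ := div_pos (by linarith) hab
  refine ⟨∑ i : Fin d, (∑' m : ℕ, (2 : ℝ≥0∞) ^ (-c * m)) *
    (∑' m : ℕ, (2 : ℝ≥0∞) ^ (-δ * m)) ^ Fintype.card {j : Fin d // j ≠ i}, ?_, fun R => ?_⟩
  · exact ENNReal.sum_ne_top.2 fun i _ => ENNReal.mul_ne_top (tsum_two_rpow_ne_top hc0)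
      (ENNReal.pow_ne_top (tsum_two_rpow_ne_top hδ0))
  -- Summing over all positions `i` of the maximum allows the constraint that `m` is maximal to be
  -- dropped.
  let F : (i : Fin d) → ℕ → ({j // j ≠ i} → ℕ) → ℝ≥0∞ := fun i m b =>
    (if R - (∑ s, (b s : ℝ)) * (α / (α + β)) ≤ m then (2 : ℝ≥0∞) ^ (-c * m) else 0)
      * 2 ^ ((1 - 2 * α) * ∑ s, (b s : ℝ))
  have h1 : levelTail d α β R ≤ ∑' j : Fin d → ℕ, ∑ i, F i (j i) (fun s => j s) := by
    refine ENNReal.tsum_le_tsum fun j => ?_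
    split_ifs with hj
    · exact zero_le
    obtain ⟨i, hi⟩ := exists_sup_eq hd j
    refine le_trans ?_ (Finset.single_le_sum (f := fun i => F i (j i) (fun s => j s))
      (fun _ _ => zero_le) (Finset.mem_univ i))
    simp only [hypCrossLevels, Set.mem_ofPred_eq, not_le] at hj
    rw [hi] at hj ⊢
    rw [sum_funSplitAt i] at hj ⊢
    set B := ∑ s : {s // s ≠ i}, (j s : ℝ)
    have hd' : (1 : ℝ) ≤ d := by exact_mod_cast hd
    have h2 : R - B * (α / (α + β)) ≤ j i := by
      rw [sub_le_iff_le_add, mul_div_assoc', ← sub_le_iff_le_add', le_div_iff₀ hab]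
      have h3 : (1 - -β / α) * R < (j i + B) - -β / α * j i := by linarith
      have h4 : α * ((1 - -β / α) * R) < α * ((j i + B) - -β / α * j i) :=
        mul_lt_mul_of_pos_left h3 hα
      have h5 : α * ((1 - -β / α) * R) = (α + β) * R := by field_simp; ring
      have h6 : α * ((j i + B) - -β / α * j i) = (α + β) * j i + α * B := by field_simp; ring
      linarith
    simp only [F]
    rw [if_pos h2, ← two_rpow_add]
    refine two_rpow_mono (le_of_eq ?_)
    simp only [hc]
    ring
  refine h1.trans ?_
  rw [Summable.tsum_finsetSum (fun i _ => ENNReal.summable), Finset.sum_mul]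
  refine Finset.sum_le_sum fun i _ => ?_
  have htail := fun x => tsum_two_rpow_tail_le c x hc0
  generalize (∑' m : ℕ, (2 : ℝ≥0∞) ^ (-c * m)) = K at htail ⊢
  rw [tsum_funSplitAt i, ← tsum_two_rpow_sum_le, mul_assoc, ← ENNReal.tsum_mul_right,
    ← ENNReal.tsum_mul_left]
  refine ENNReal.tsum_le_tsum fun b => ?_
  simp only [F]
  rw [ENNReal.tsum_mul_right]
  refine (mul_le_mul_left (htail _) _).trans ?_
  rw [mul_assoc, ← two_rpow_add, ← two_rpow_add]
  refine mul_le_mul_right (two_rpow_mono (le_of_eq ?_)) _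
  simp only [hc, hδ]
  field_simp
  ring

open Classical in
-- The terms up to `R` equal 1 and number at most `R + 1`; the others form a convergent geometric
-- tail.
theorem tsum_max_le {c : ℝ} (hc : 0 < c) : ∃ K : ℝ≥0∞, K ≠ ∞ ∧ ∀ R : ℝ, 1 ≤ R →
    ∑' m : ℕ, (2 : ℝ≥0∞) ^ (-c * max ((m : ℝ) - R) 0) ≤ K * ENNReal.ofReal R := by
  refine ⟨2 + ∑' m : ℕ, (2 : ℝ≥0∞) ^ (-c * m), 
    ENNReal.add_ne_top.2 ⟨by simp, tsum_two_rpow_ne_top hc⟩, fun R hR => ?_⟩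
  have h1 : ∀ m : ℕ, (2 : ℝ≥0∞) ^ (-c * max ((m : ℝ) - R) 0)
      ≤ (if (m : ℝ) ≤ R then 1 else 0) +
        (if R ≤ m then (2 : ℝ≥0∞) ^ (-c * m) else 0) * 2 ^ (c * R) := by
    intro m
    rcases le_or_gt (m : ℝ) R with h | h
    · rw [if_pos h, max_eq_right (by linarith), mul_zero, ENNReal.rpow_zero]
      exact le_self_add
    · rw [if_neg (not_le.2 h), if_pos h.le, max_eq_left (by linarith), zero_add, ← two_rpow_add]
      exact two_rpow_mono (by linarith)
  refine (ENNReal.tsum_le_tsum h1).trans ?_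
  rw [ENNReal.tsum_add, ENNReal.tsum_mul_right, add_mul]
  have hR1 : (1 : ℝ≥0∞) ≤ ENNReal.ofReal R := by simpa using hR
  refine add_le_add ?_ ?_
  · rw [tsum_eq_sum (s := Finset.range (⌊R⌋₊ + 1))]
    · refine (Finset.sum_le_sum (g := fun _ => (1 : ℝ≥0∞)) fun m _ => ?_).trans ?_
      · split_ifs <;> simp
      · simp only [Finset.sum_const, Finset.card_range, nsmul_eq_mul, mul_one, Nat.cast_add,
          Nat.cast_one, two_mul]
        gcongr
        rw [← ENNReal.ofReal_natCast]
        exact ENNReal.ofReal_le_ofReal (Nat.floor_le (by linarith))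
    · intro m hm
      rw [if_neg]
      intro h
      exact hm (Finset.mem_range.2 (Nat.lt_succ_of_le (Nat.le_floor h)))
  · refine (mul_le_mul_left (tsum_two_rpow_tail_le c R hc) _).trans ?_
    rw [mul_assoc, ← two_rpow_add]
    refine mul_le_mul_right ?_ _
    simpa using hR

open Classical in
-- The maximum does not enter here, so a fixed coordinate is summed first. What remains decays only
-- in the excess of `B` over `R`; this is distributed over the `d - 1` other coordinates, so the sum
-- factorises and each factor costs a multiple of `R`.
theorem levelTail_le_of_zero (hd : 2 ≤ d) {α : ℝ} (hα : 1 / 2 < α) :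
    ∃ K : ℝ≥0∞, K ≠ ∞ ∧ ∀ R : ℝ, 1 ≤ R →
      levelTail d α 0 R ≤ K * 2 ^ (-(2 * α - 1) * R) * ENNReal.ofReal R ^ (d - 1) := by
  set c := 2 * α - 1 with hc
  have hc0 : 0 < c := by linarith
  have hd0 : (0 : ℝ) < ((d - 1 : ℕ) : ℝ) := by exact_mod_cast (by omega : 0 < d - 1)
  obtain ⟨K, hK, hKR⟩ := tsum_max_le (div_pos hc0 hd0)
  refine ⟨(∑' m : ℕ, (2 : ℝ≥0∞) ^ (-c * m)) * K ^ (d - 1),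
    ENNReal.mul_ne_top (tsum_two_rpow_ne_top hc0) (ENNReal.pow_ne_top hK), fun R hR => ?_⟩
  let i : Fin d := ⟨0, by omega⟩
  have hcard : Fintype.card {j : Fin d // j ≠ i} = d - 1 := by
    simp [Fintype.card_subtype_compl]
  let F : ℕ → ({j // j ≠ i} → ℕ) → ℝ≥0∞ := fun m b =>
    (if R - ∑ s, (b s : ℝ) ≤ m then (2 : ℝ≥0∞) ^ (-c * m) else 0) * 2 ^ (-c * ∑ s, (b s : ℝ))
  have h1 : levelTail d α 0 R ≤ ∑' j : Fin d → ℕ, F (j i) (fun s => j s) := by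
    refine ENNReal.tsum_le_tsum fun j => ?_
    split_ifs with hj
    · exact zero_le
    simp only [hypCrossLevels, Set.mem_ofPred_eq, not_le, neg_zero, zero_div, zero_mul, sub_zero,
      one_mul] at hj
    rw [sum_funSplitAt i] at hj ⊢
    have hd' : (2 : ℝ) ≤ d := by exact_mod_cast hd
    simp only [F]
    rw [if_pos (by linarith), ← two_rpow_add]
    refine two_rpow_mono (le_of_eq ?_)
    simp only [hc]
    ring
  refine h1.trans ?_
  rw [tsum_funSplitAt i]
  have h2 : ∀ b : {j // j ≠ i} → ℕ, ∑' m, F m b ≤ (∑' m : ℕ, (2 : ℝ≥0∞) ^ (-c * m)) *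
      2 ^ (-c * R) * ∏ s, (2 : ℝ≥0∞) ^ (-(c / (d - 1 : ℕ)) * max ((b s : ℝ) - R) 0) := by
    intro b
    simp only [F]
    rw [ENNReal.tsum_mul_right]
    set B := ∑ s, (b s : ℝ) with hB
    -- Since `m ≥ 0`, the threshold may be replaced by its positive part; otherwise the bound would
    -- be useless for `B > R`.
    have h3 : (∑' m : ℕ, if R - B ≤ m then (2 : ℝ≥0∞) ^ (-c * m) else 0)
        ≤ (∑' m : ℕ, (2 : ℝ≥0∞) ^ (-c * m)) * 2 ^ (-c * max (R - B) 0) := by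
      refine le_trans (le_of_eq ?_) (tsum_two_rpow_tail_le c _ hc0)
      refine tsum_congr fun m => ?_
      simp
    refine (mul_le_mul_left h3 _).trans ?_
    rw [mul_assoc, mul_assoc, ← two_rpow_add, ← two_rpow_sum, ← two_rpow_add, ← Finset.mul_sum]
    refine mul_le_mul_right (two_rpow_mono ?_) _
    have h4 : ∑ s, max ((b s : ℝ) - R) 0 ≤ (d - 1 : ℕ) * max (B - R) 0 := by
      rw [← hcard, ← nsmul_eq_mul, ← Finset.card_univ, ← Finset.sum_const]
      refine Finset.sum_le_sum fun s _ => max_le_max_right _ (sub_le_sub_right ?_ _)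
      exact Finset.single_le_sum (f := fun s => (b s : ℝ)) (fun _ _ => Nat.cast_nonneg _)
        (Finset.mem_univ s)
    have h5 : c / (d - 1 : ℕ) * ∑ s, max ((b s : ℝ) - R) 0 ≤ c * max (B - R) 0 := by
      calc _ ≤ c / (d - 1 : ℕ) * ((d - 1 : ℕ) * max (B - R) 0) := by gcongr
        _ = _ := by field_simp
    have h6 : max (R - B) 0 + B = R + max (B - R) 0 := by
      rcases le_total R B with h | h
      · rw [max_eq_right (by linarith), max_eq_left (by linarith)]; ring
      · rw [max_eq_left (by linarith), max_eq_right (by linarith)]; ring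
    nlinarith
  refine (ENNReal.tsum_le_tsum h2).trans ?_
  rw [ENNReal.tsum_mul_left, tsum_pi_prod fun m : ℕ =>
    (2 : ℝ≥0∞) ^ (-(c / (d - 1 : ℕ)) * max ((m : ℝ) - R) 0), hcard]
  calc _ ≤ (∑' m : ℕ, (2 : ℝ≥0∞) ^ (-c * m)) * 2 ^ (-c * R) *
        (K * ENNReal.ofReal R) ^ (d - 1) := by
        gcongr
        exact hKR R hR
    _ = _ := by
      rw [mul_pow]
      ring

end TailSums

/-! ### The inverse-weight sum outside the cross. -/

section Truncation

variable {d : ℕ}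

theorem ofReal_two_rpow (x : ℝ) : ENNReal.ofReal (2 ^ x) = 2 ^ x := by
  rw [← ENNReal.ofReal_rpow_of_pos two_pos, ENNReal.ofReal_ofNat]

open Classical in
theorem tsum_compl_hypCross_le_levelTail {α β : ℝ} (hα : 0 ≤ α) (hβ : β ≤ 0) (R : ℝ) :
    ∑' k : ↥(hypCross d (-β / α) R)ᶜ, ENNReal.ofReal (hybridWeight α β k.1)⁻¹
      ≤ ENNReal.ofReal ((1 + d) ^ (-β) * 2 ^ (2 * α * d)) * 3 ^ d * levelTail d α β R := by
  rw [tsum_subtype (hypCross d (-β / α) R)ᶜ fun k => ENNReal.ofReal (hybridWeight α β k)⁻¹]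
  let G : (Fin d → ℕ) → ℝ≥0∞ := fun j => if j ∈ hypCrossLevels d (-β / α) R then 0 else
    (2 : ℝ≥0∞) ^ (-2 * α * (∑ s, (j s : ℝ)) - 2 * β * ((Finset.univ.sup j : ℕ) : ℝ))
  have h1 : ∀ k : Fin d → ℤ, (hypCross d (-β / α) R)ᶜ.indicator
      (fun k => ENNReal.ofReal (hybridWeight α β k)⁻¹) k
      ≤ ENNReal.ofReal ((1 + d) ^ (-β) * 2 ^ (2 * α * d)) * G (fun s => dyadicLevel (k s)) := by
    intro k
    by_cases hk : k ∈ hypCross d (-β / α) R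
    · rw [Set.indicator_of_notMem (by simpa using hk)]
      exact zero_le
    · rw [Set.indicator_of_mem (by simpa using hk)]
      simp only [G]
      rw [if_neg (mt (mem_hypCross_iff _ _ _).2 hk), ← ofReal_two_rpow,
        ← ENNReal.ofReal_mul (by positivity)]
      exact ENNReal.ofReal_le_ofReal (inv_hybridWeight_le hα hβ k)
  refine (ENNReal.tsum_le_tsum h1).trans ?_
  rw [ENNReal.tsum_mul_left, mul_assoc (ENNReal.ofReal _)]
  refine mul_le_mul_right ((tsum_dyadicLevel_le G).trans (le_of_eq ?_)) _
  congr 1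
  refine tsum_congr fun j => ?_
  simp only [G]
  split_ifs
  · simp
  · rw [← two_rpow_sum, ← two_rpow_add]
    ring_nf

theorem refinementRate_pos (d : ℕ) (α β : ℝ) {R : ℝ} (hR : 1 ≤ R) :
    0 < refinementRate d α β R := by
  unfold refinementRate
  have : 0 < R := by linarith
  split_ifs <;> positivity

theorem ofReal_refinementRate_sq (hd : 1 ≤ d) (α β : ℝ) {R : ℝ} (hR : 1 ≤ R) :
    ENNReal.ofReal (refinementRate d α β R ^ 2)
      = 2 ^ (-(2 * (α + β) - 1) * R) * (if β = 0 then ENNReal.ofReal R ^ (d - 1) else 1) := by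
  have hR0 : 0 ≤ R := by linarith
  unfold refinementRate
  rw [mul_pow, ENNReal.ofReal_mul (by positivity), ← Real.rpow_natCast, ← Real.rpow_mul two_pos.le,
    ofReal_two_rpow]
  congr 1
  · push_cast
    ring_nf
  · split_ifs
    · rw [← Real.rpow_natCast, ← Real.rpow_mul hR0, ← ENNReal.ofReal_pow hR0,
        ← Real.rpow_natCast R]
      push_cast [Nat.cast_sub hd]
      ring_nf
    · simp

theorem tsum_compl_hypCross_le (hd : 2 ≤ d) {α β : ℝ} (hα : 1 / 2 < α) (hβ : β ≤ 0)
    (hαβ : 1 / 2 < α + β) : ∃ C : ℝ, 0 < C ∧ ∀ R : ℝ, 1 ≤ R →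
      ∑' k : ↥(hypCross d (-β / α) R)ᶜ, ENNReal.ofReal (hybridWeight α β k.1)⁻¹
        ≤ ENNReal.ofReal ((C * refinementRate d α β R) ^ 2) := by
  obtain ⟨K, hK, hKR⟩ : ∃ K : ℝ≥0∞, K ≠ ∞ ∧ ∀ R : ℝ, 1 ≤ R →
      levelTail d α β R ≤ K * ENNReal.ofReal (refinementRate d α β R ^ 2) := by
    rcases hβ.lt_or_eq with hβ | rfl
    · obtain ⟨K, hK, h⟩ := levelTail_le_of_neg (d := d) (by omega) hβ hαβ
      refine ⟨K, hK, fun R hR => ?_⟩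
      rw [ofReal_refinementRate_sq (by omega) α β hR, if_neg hβ.ne, mul_one]
      exact h R
    · obtain ⟨K, hK, h⟩ := levelTail_le_of_zero hd hα
      refine ⟨K, hK, fun R hR => ?_⟩
      rw [ofReal_refinementRate_sq (by omega) α 0 hR, if_pos rfl, ← mul_assoc, add_zero]
      exact h R hR
  set L := ENNReal.ofReal ((1 + d) ^ (-β) * 2 ^ (2 * α * d)) * 3 ^ d * K with hL
  have hLt : L ≠ ∞ := ENNReal.mul_ne_top (ENNReal.mul_ne_top ENNReal.ofReal_ne_top (by simp)) hK
  -- The constant enters squared, and `(L + 1) ^ 2 ≥ L` avoids a square root.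
  refine ⟨L.toReal + 1, by positivity, fun R hR => ?_⟩
  refine (tsum_compl_hypCross_le_levelTail (by linarith) hβ R).trans ?_
  refine (mul_le_mul_right (hKR R hR) _).trans ?_
  rw [← mul_assoc, ← hL, mul_pow, ENNReal.ofReal_mul (by positivity)]
  refine mul_le_mul_left ?_ _
  rw [← ENNReal.ofReal_toReal hLt]
  refine ENNReal.ofReal_le_ofReal ?_
  have : 0 ≤ L.toReal := ENNReal.toReal_nonneg
  rw [ENNReal.toReal_ofReal this]
  nlinarith

theorem neg_div_lt_one {α β : ℝ} (hα : 0 < α) (hαβ : 0 < α + β) : -β / α < 1 := by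
  rw [div_lt_one hα]
  linarith

/-- The tail bound at `R = 1` leaves only the finitely many frequencies of one cross. -/
theorem tsum_inv_hybridWeight_ne_top (hd : 2 ≤ d) {α β : ℝ} (hα : 1 / 2 < α) (hβ : β ≤ 0)
    (hαβ : 1 / 2 < α + β) :
    ∑' k : Fin d → ℤ, ENNReal.ofReal (hybridWeight α β k)⁻¹ ≠ ∞ := by
  obtain ⟨C, hC, h⟩ := tsum_compl_hypCross_le hd hα hβ hαβ
  have hfin := hypCross_finite d
    (neg_div_lt_one (α := α) (β := β) (by linarith) (by linarith)) 1
  rw [← Summable.tsum_add_tsum_compl (s := hypCross d (-β / α) 1) ENNReal.summable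
    ENNReal.summable]
  refine ENNReal.add_ne_top.2 ⟨?_, ne_top_of_le_ne_top ENNReal.ofReal_ne_top (h 1 le_rfl)⟩
  have := hfin.fintype
  rw [tsum_fintype]
  exact ENNReal.sum_ne_top.2 fun _ _ => ENNReal.ofReal_ne_top

end Truncation

/-! ### Sizes of the cross and of its difference set. -/

section Cardinality

variable {d : ℕ}

open Classical in
theorem encard_le_tsum_levels (S : Set (Fin d → ℤ)) (P : (Fin d → ℕ) → Prop)
    (h : ∀ k ∈ S, P fun s => dyadicLevel (k s)) :
    (S.encard : ℝ≥0∞) ≤ 3 ^ d *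
      ∑' j : Fin d → ℕ, if P j then (2 : ℝ≥0∞) ^ (∑ s, (j s : ℝ)) else 0 := by
  rw [← ENNReal.tsum_set_one, tsum_subtype S fun _ => (1 : ℝ≥0∞)]
  refine (ENNReal.tsum_le_tsum fun k => ?_).trans
    ((tsum_dyadicLevel_le fun j => if P j then 1 else 0).trans (le_of_eq ?_))
  · by_cases hk : k ∈ S
    · rw [if_pos (h k hk), Set.indicator_of_mem hk]
    · rw [Set.indicator_of_notMem hk]
      exact zero_le
  · congr 1
    refine tsum_congr fun j => ?_
    split_ifs
    · rw [two_rpow_sum, mul_one]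
    · rw [mul_zero]

open Classical in
-- The same splitting at the largest level: its geometric sum is dominated by the top term, and the
-- other levels again leave `2 ^ (-δ * B)`.
theorem encard_hypCross_le_of_neg (hd : 1 ≤ d) {α β : ℝ} (hβ : β < 0)
    (hαβ : 0 < α + β) : ∃ K : ℝ≥0∞, K ≠ ∞ ∧ ∀ R : ℝ,
      ((hypCross d (-β / α) R).encard : ℝ≥0∞) ≤ K * 2 ^ R := by
  set δ := -β / (α + β) with hδ
  have hα : 0 < α := by linarith
  have hδ0 : 0 < δ := div_pos (by linarith) hαβ
  -- The slack `d - 1` of the level set, divided by `1 - T = (α + β) / α`.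
  set ρ := ((d : ℝ) - 1) * (α / (α + β)) with hρ
  refine ⟨3 ^ d * ∑ i : Fin d, 2 * 2 ^ ρ *
    (∑' m : ℕ, (2 : ℝ≥0∞) ^ (-δ * m)) ^ Fintype.card {j : Fin d // j ≠ i}, ?_, fun R => ?_⟩
  · exact ENNReal.mul_ne_top (by simp) (ENNReal.sum_ne_top.2 fun i _ =>
      ENNReal.mul_ne_top (ENNReal.mul_ne_top (by simp) (two_rpow_ne_top _))
      (ENNReal.pow_ne_top (tsum_two_rpow_ne_top hδ0)))
  refine (encard_le_tsum_levels _ (fun j => j ∈ hypCrossLevels d (-β / α) R)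
    fun k hk => (mem_hypCross_iff _ _ _).1 hk).trans ?_
  rw [mul_assoc]
  refine mul_le_mul_right ?_ _
  let F : (i : Fin d) → ℕ → ({j // j ≠ i} → ℕ) → ℝ≥0∞ := fun i m b =>
    (if (m : ℝ) ≤ R + ρ - (∑ s, (b s : ℝ)) * (α / (α + β)) then (2 : ℝ≥0∞) ^ (m : ℝ) else 0)
      * 2 ^ (∑ s, (b s : ℝ))
  have h1 : (∑' j : Fin d → ℕ, if j ∈ hypCrossLevels d (-β / α) R
      then (2 : ℝ≥0∞) ^ (∑ s, (j s : ℝ)) else 0)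
      ≤ ∑' j : Fin d → ℕ, ∑ i, F i (j i) (fun s => j s) := by
    refine ENNReal.tsum_le_tsum fun j => ?_
    split_ifs with hj
    swap
    · exact zero_le
    obtain ⟨i, hi⟩ := exists_sup_eq hd j
    refine le_trans ?_ (Finset.single_le_sum (f := fun i => F i (j i) (fun s => j s))
      (fun _ _ => zero_le) (Finset.mem_univ i))
    simp only [hypCrossLevels, Set.mem_ofPred_eq] at hj
    rw [hi] at hj
    rw [sum_funSplitAt i] at hj ⊢
    set B := ∑ s : {s // s ≠ i}, (j s : ℝ)
    have h2 : (j i : ℝ) ≤ R + ρ - B * (α / (α + β)) := by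
      rw [hρ]
      have h3 : α * ((j i + B) - -β / α * j i) ≤ α * ((1 - -β / α) * R + d - 1) :=
        mul_le_mul_of_nonneg_left hj hα.le
      have h5 : α * ((1 - -β / α) * R + d - 1) = (α + β) * R + α * (d - 1) := by field_simp; ring
      have h6 : α * ((j i + B) - -β / α * j i) = (α + β) * j i + α * B := by field_simp; ring
      have h7 : R + ((d : ℝ) - 1) * (α / (α + β)) - B * (α / (α + β))
        = ((α + β) * R + α * (d - 1) - α * B) / (α + β) := by field_simp
      rw [h7, le_div_iff₀ hαβ]
      linarith
    simp only [F]
    rw [if_pos h2, ← two_rpow_add]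
  refine h1.trans ?_
  rw [Summable.tsum_finsetSum (fun i _ => ENNReal.summable), Finset.sum_mul]
  refine Finset.sum_le_sum fun i _ => ?_
  rw [tsum_funSplitAt i, ← tsum_two_rpow_sum_le, mul_assoc, ← ENNReal.tsum_mul_right,
    ← ENNReal.tsum_mul_left]
  refine ENNReal.tsum_le_tsum fun b => ?_
  simp only [F]
  rw [ENNReal.tsum_mul_right]
  refine (mul_le_mul_left (tsum_two_rpow_head_le _) _).trans ?_
  rw [mul_assoc, mul_assoc, ← two_rpow_add, ← two_rpow_add, ← two_rpow_add]
  refine mul_le_mul_right (two_rpow_mono (le_of_eq ?_)) _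
  simp only [hδ]
  field_simp
  ring

open Classical in
-- Once the other coordinates are fixed, summing over one of them yields `2 * 2 ^ n` regardless of
-- their values; at most `n + 1` values are possible for each.
theorem tsum_simplex_le {ι : Type*} [Fintype ι] [Nonempty ι] {n : ℝ} (hn : 0 ≤ n) :
    ∑' a : ι → ℕ, (if ∑ s, (a s : ℝ) ≤ n then (2 : ℝ≥0∞) ^ (∑ s, (a s : ℝ)) else 0)
      ≤ 2 * 2 ^ n * ENNReal.ofReal (n + 1) ^ (Fintype.card ι - 1) := by
  let i : ι := Classical.arbitrary ι
  have hcard : Fintype.card {j : ι // j ≠ i} = Fintype.card ι - 1 := by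
    simp [Fintype.card_subtype_compl]
  let F : ℕ → ({j // j ≠ i} → ℕ) → ℝ≥0∞ := fun m b =>
    (if (m : ℝ) ≤ n - ∑ s, (b s : ℝ) then (2 : ℝ≥0∞) ^ (m : ℝ) else 0) * (2 ^ (∑ s, (b s : ℝ)))
  have h1 : ∀ a : ι → ℕ, (if ∑ s, (a s : ℝ) ≤ n then (2 : ℝ≥0∞) ^ (∑ s, (a s : ℝ)) else 0)
      = F (a i) (fun s => a s) := by
    intro a
    simp only [F]
    rw [sum_funSplitAt i, two_rpow_add]
    simp only [le_sub_iff_add_le, ite_mul, zero_mul]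
  rw [tsum_congr h1, tsum_funSplitAt i]
  have h2 : ∀ b : {j // j ≠ i} → ℕ, ∑' m, F m b
      ≤ 2 * 2 ^ n * ∏ s, (if (b s : ℝ) ≤ n then (1 : ℝ≥0∞) else 0) := by
    intro b
    simp only [F]
    rw [ENNReal.tsum_mul_right]
    by_cases hb : ∀ s, (b s : ℝ) ≤ n
    · refine (mul_le_mul_left (tsum_two_rpow_head_le _) _).trans ?_
      rw [mul_assoc, ← two_rpow_add]
      simp [hb]
    · push Not at hb
      obtain ⟨s, hs⟩ := hb
      have h3 : (b s : ℝ) ≤ ∑ s, (b s : ℝ) :=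
        Finset.single_le_sum (f := fun s => (b s : ℝ)) (fun _ _ => Nat.cast_nonneg _)
          (Finset.mem_univ s)
      have h4 : ∀ m : ℕ, ¬ (m : ℝ) ≤ n - ∑ s, (b s : ℝ) := fun m hm => by
        have : (0 : ℝ) ≤ m := Nat.cast_nonneg m
        linarith
      simp [h4]
  refine (ENNReal.tsum_le_tsum h2).trans ?_
  rw [ENNReal.tsum_mul_left, tsum_pi_prod fun m : ℕ => if (m : ℝ) ≤ n then (1 : ℝ≥0∞) else 0, hcard]
  gcongr
  rw [tsum_eq_sum (s := Finset.range (⌊n⌋₊ + 1))]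
  · refine (Finset.sum_le_sum (g := fun _ => (1 : ℝ≥0∞)) fun m _ => ?_).trans ?_
    · split_ifs <;> simp
    · simp only [Finset.sum_const, Finset.card_range, nsmul_eq_mul, mul_one]
      rw [← ENNReal.ofReal_natCast]
      refine ENNReal.ofReal_le_ofReal ?_
      push_cast
      linarith [Nat.floor_le hn]
  · intro m hm
    rw [if_neg]
    intro h
    exact hm (Finset.mem_range.2 (Nat.lt_succ_of_le (Nat.le_floor h)))

open Classical in
theorem tsum_two_simplices_le (hd : 2 ≤ d) {n : ℝ} (hn : 1 ≤ n) (A : Finset (Fin d)) :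
    ∑' j : Fin d → ℕ, (if ∑ s ∈ A, (j s : ℝ) ≤ n ∧ ∑ s ∈ Aᶜ, (j s : ℝ) ≤ n
      then (2 : ℝ≥0∞) ^ (∑ s, (j s : ℝ)) else 0)
      ≤ 4 * 2 ^ (2 * n) * ENNReal.ofReal (n + 1) ^ (d - 2) := by
  have hA1 : ∀ f : Fin d → ℝ, ∑ s ∈ A, f s = ∑ s : {s // s ∈ A}, f s := fun f =>
    Finset.sum_subtype A (fun _ => Iff.rfl) f
  have hA2 : ∀ f : Fin d → ℝ, ∑ s ∈ Aᶜ, f s = ∑ s : {s // s ∉ A}, f s := fun f =>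
    Finset.sum_subtype Aᶜ (fun _ => Finset.mem_compl) f
  have h0 : ∑' j : Fin d → ℕ, (if ∑ s ∈ A, (j s : ℝ) ≤ n ∧ ∑ s ∈ Aᶜ, (j s : ℝ) ≤ n
        then (2 : ℝ≥0∞) ^ (∑ s, (j s : ℝ)) else 0)
      = (∑' a : {s // s ∈ A} → ℕ,
          if ∑ s, (a s : ℝ) ≤ n then (2 : ℝ≥0∞) ^ (∑ s, (a s : ℝ)) else 0) *
        (∑' b : {s // s ∉ A} → ℕ,
          if ∑ s, (b s : ℝ) ≤ n then (2 : ℝ≥0∞) ^ (∑ s, (b s : ℝ)) else 0) := by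
    rw [← ENNReal.tsum_mul_right]
    simp_rw [← ENNReal.tsum_mul_left]
    rw [← ENNReal.tsum_prod, ← (Equiv.piEquivPiSubtypeProd (· ∈ A) fun _ => ℕ).tsum_eq]
    refine tsum_congr fun j => ?_
    simp only [Equiv.piEquivPiSubtypeProd_apply]
    rw [← Finset.sum_add_sum_compl A, two_rpow_add, hA1, hA2, ite_and]
    split_ifs <;> simp
  have hcardA : Fintype.card {s // s ∈ A} = A.card := Fintype.card_coe A
  have hcardA' : Fintype.card {s // s ∉ A} = d - A.card := by
    rw [Fintype.card_subtype_compl, Fintype.card_fin, hcardA]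
  have hle : A.card ≤ d := by simpa using A.card_le_univ
  have hN : ENNReal.ofReal (n + 1) ≤ 2 ^ n := by
    rw [← ofReal_two_rpow]
    refine ENNReal.ofReal_le_ofReal ?_
    have := one_add_mul_self_le_rpow_one_add (by norm_num : (-1 : ℝ) ≤ 1) hn
    rw [one_add_one_eq_two] at this
    linarith
  -- If `A` or its complement is empty there is one power of `n + 1` too many, but also a spare
  -- factor `2 ^ n` to absorb it.
  have hone : 2 * 2 ^ n * ENNReal.ofReal (n + 1) ^ (d - 1)
      ≤ 4 * 2 ^ (2 * n) * ENNReal.ofReal (n + 1) ^ (d - 2) := by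
    rw [show d - 1 = d - 2 + 1 by omega, pow_succ, two_mul n, two_rpow_add]
    calc 2 * 2 ^ n * (ENNReal.ofReal (n + 1) ^ (d - 2) * ENNReal.ofReal (n + 1))
        ≤ 4 * 2 ^ n * (ENNReal.ofReal (n + 1) ^ (d - 2) * 2 ^ n) := by
          gcongr
          norm_num
      _ = _ := by ring
  have hempty : ∀ (ι : Type) [Fintype ι] [IsEmpty ι], ∑' a : ι → ℕ,
      (if ∑ s, (a s : ℝ) ≤ n then (2 : ℝ≥0∞) ^ (∑ s, (a s : ℝ)) else 0) = 1 := by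
    intro ι _ _
    simp [tsum_fintype, (by linarith : (0 : ℝ) ≤ n)]
  have hn0 : 0 ≤ n := by linarith
  rw [h0]
  rcases Nat.eq_zero_or_pos A.card with hA | hA
  · have : IsEmpty {s // s ∈ A} := Fintype.card_eq_zero_iff.1 (hcardA.trans hA)
    have : Nonempty {s // s ∉ A} := Fintype.card_pos_iff.1 (by omega)
    rw [hempty, one_mul]
    refine (tsum_simplex_le hn0).trans ?_
    rwa [hcardA', hA]
  rcases hle.eq_or_lt with hA' | hA'
  · have : Nonempty {s // s ∈ A} := Fintype.card_pos_iff.1 (by omega)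
    have : IsEmpty {s // s ∉ A} := Fintype.card_eq_zero_iff.1 (by omega)
    rw [hempty {s // s ∉ A}, mul_one]
    refine (tsum_simplex_le hn0).trans ?_
    rwa [hcardA, hA']
  · have : Nonempty {s // s ∈ A} := Fintype.card_pos_iff.1 (by omega)
    have : Nonempty {s // s ∉ A} := Fintype.card_pos_iff.1 (by omega)
    refine (mul_le_mul' (tsum_simplex_le hn0) (tsum_simplex_le hn0)).trans (le_of_eq ?_)
    rw [hcardA, hcardA', show d - 2 = (A.card - 1) + (d - A.card - 1) by omega,
      pow_add, two_mul n, two_rpow_add]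
    ring

theorem dyadicLevel_sub_le {k l : ℤ} (h : dyadicLevel l ≤ dyadicLevel k) :
    dyadicLevel (k - l) ≤ dyadicLevel k + 1 := by
  rw [dyadicLevel_le_iff] at h ⊢
  have h1 := (dyadicLevel_le_iff k _).1 le_rfl
  rw [pow_succ]
  omega

open Classical in
-- Let `A` be the coordinates where `k` has at least the level of `l`. On `A` the levels of `k - l`
-- exceed those of `k` by at most 1, off `A` those of `l`. So they lie in a product of two
-- simplices, and each nonempty factor saves one logarithm.
theorem encard_diffSet_hypCross_zero_le (hd : 2 ≤ d) : ∃ K : ℝ≥0∞, K ≠ ∞ ∧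
    ∀ R : ℝ, 1 ≤ R → ((diffSet (hypCross d 0 R)).encard : ℝ≥0∞)
      ≤ K * (2 ^ (2 * R) * ENNReal.ofReal R ^ (d - 2)) := by
  refine ⟨3 ^ d * (Fintype.card (Finset (Fin d)) *
    (4 * 2 ^ (4 * (d : ℝ)) * ENNReal.ofReal (2 * d + 2) ^ (d - 2))), ?_, fun R hR => ?_⟩
  · refine ENNReal.mul_ne_top (by simp) (ENNReal.mul_ne_top (by simp) (ENNReal.mul_ne_top
      (ENNReal.mul_ne_top (by simp) (two_rpow_ne_top _)) (ENNReal.pow_ne_top ENNReal.ofReal_ne_top)))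
  -- Covers the slack `d - 1` of the level set plus one extra level per coordinate.
  set n : ℝ := R + 2 * d with hn
  have hd0 : (0 : ℝ) ≤ d := Nat.cast_nonneg d
  let P : Finset (Fin d) → (Fin d → ℕ) → Prop := fun A j =>
    ∑ s ∈ A, (j s : ℝ) ≤ n ∧ ∑ s ∈ Aᶜ, (j s : ℝ) ≤ n
  let Q : (Fin d → ℕ) → Prop := fun j => ∃ A, P A j
  refine (encard_le_tsum_levels _ Q ?_).trans ?_
  · rintro h ⟨k, hk, l, hl, rfl⟩
    have key : ∀ k ∈ hypCross d 0 R, ∀ l : Fin d → ℤ, ∀ A : Finset (Fin d),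
        (∀ s ∈ A, dyadicLevel (l s) ≤ dyadicLevel (k s)) →
        ∑ s ∈ A, (dyadicLevel (k s - l s) : ℝ) ≤ n := by
      intro k hk l A hA
      rw [mem_hypCross_iff] at hk
      simp only [hypCrossLevels, Set.mem_ofPred_eq, zero_mul, sub_zero, one_mul] at hk
      have h4 : ∀ s ∈ A, (dyadicLevel (k s - l s) : ℝ) ≤ dyadicLevel (k s) + 1 :=
        fun s hs => by exact_mod_cast dyadicLevel_sub_le (hA s hs)
      refine (Finset.sum_le_sum h4).trans ?_
      rw [Finset.sum_add_distrib]
      have h2 : ∑ s ∈ A, (1 : ℝ) ≤ d := by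
        simp only [Finset.sum_const, nsmul_eq_mul, mul_one, Nat.cast_le]
        simpa using A.card_le_univ
      have h3 : ∑ s ∈ A, (dyadicLevel (k s) : ℝ) ≤ ∑ s, (dyadicLevel (k s) : ℝ) :=
        Finset.sum_le_sum_of_subset_of_nonneg (Finset.subset_univ _)
          fun _ _ _ => Nat.cast_nonneg _
      linarith
    refine ⟨Finset.univ.filter fun s : Fin d => dyadicLevel (l s) ≤ dyadicLevel (k s), ?_, ?_⟩
    · exact key k hk l _ fun s hs => (Finset.mem_filter.1 hs).2
    · refine le_trans (le_of_eq (Finset.sum_congr rfl fun s _ => ?_))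
        (key l hl k _ fun s hs => ?_)
      · simp only [dyadicLevel, Pi.sub_apply]
        rw [← Int.natAbs_neg, neg_sub]
      · simp only [Finset.mem_compl, Finset.mem_filter, Finset.mem_univ, true_and, not_le] at hs
        exact hs.le
  rw [mul_assoc]
  refine mul_le_mul_right ?_ _
  refine (ENNReal.tsum_le_tsum (g := fun j => ∑ A : Finset (Fin d),
      if ∑ s ∈ A, (j s : ℝ) ≤ n ∧ ∑ s ∈ Aᶜ, (j s : ℝ) ≤ n
        then (2 : ℝ≥0∞) ^ (∑ s, (j s : ℝ)) else 0) fun j => ?_).trans ?_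
  · split_ifs with h
    · obtain ⟨A, hA⟩ := h
      refine le_trans ?_ (Finset.single_le_sum (f := fun A => if ∑ s ∈ A, (j s : ℝ) ≤ n ∧
        ∑ s ∈ Aᶜ, (j s : ℝ) ≤ n then (2 : ℝ≥0∞) ^ (∑ s, (j s : ℝ)) else 0)
        (fun _ _ => zero_le) (Finset.mem_univ A))
      exact (if_pos hA).ge
    · exact zero_le
  rw [Summable.tsum_finsetSum (fun i _ => ENNReal.summable)]
  refine (Finset.sum_le_sum fun A _ => tsum_two_simplices_le hd (n := n) (by linarith) A).trans ?_
  rw [Finset.sum_const, nsmul_eq_mul, Finset.card_univ,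
    mul_assoc (Fintype.card (Finset (Fin d)) : ℝ≥0∞)]
  refine mul_le_mul_right ?_ _
  have h2 : ENNReal.ofReal (n + 1) ≤ ENNReal.ofReal (2 * d + 2) * ENNReal.ofReal R := by
    rw [← ENNReal.ofReal_mul (by positivity)]
    exact ENNReal.ofReal_le_ofReal (by nlinarith)
  calc 4 * 2 ^ (2 * n) * ENNReal.ofReal (n + 1) ^ (d - 2)
      ≤ 4 * 2 ^ (2 * n) * (ENNReal.ofReal (2 * d + 2) * ENNReal.ofReal R) ^ (d - 2) := by gcongr
    _ = _ := by
      rw [mul_pow, show 2 * n = 4 * d + 2 * R by rw [hn]; ring, two_rpow_add]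
      ring

end Cardinality

/-! ### Existence of component-by-component lattices. -/

section ComponentByComponent

variable {d : ℕ}

theorem diffSet_finite {I : Set (Fin d → ℤ)} (hI : I.Finite) : (diffSet I).Finite := by
  refine ((hI.prod hI).image fun p : (Fin d → ℤ) × (Fin d → ℤ) => p.1 - p.2).subset ?_
  rintro h ⟨k, hk, l, hl, rfl⟩
  exact ⟨(k, l), ⟨hk, hl⟩, rfl⟩

theorem encard_diffSet_le (I : Set (Fin d → ℤ)) : (diffSet I).encard ≤ I.encard * I.encard := by
  rw [← Set.encard_prod]
  refine (Set.encard_le_encard ?_).trans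
    (Set.encard_image_le (fun p : (Fin d → ℤ) × (Fin d → ℤ) => p.1 - p.2) _)
  rintro h ⟨k, hk, l, hl, rfl⟩
  exact ⟨(k, l), ⟨hk, hl⟩, rfl⟩

theorem exists_prime_cbcSize {I : Set (Fin d → ℤ)} {B : ℕ} (hB0 : 0 < B)
    (hB : ∀ h ∈ diffSet I, ∀ s, |h s| ≤ (B : ℤ)) :
    ∃ p ≤ 2 * max (diffSet I).ncard B,
      p.Prime ∧ (diffSet I).ncard ≤ p ∧ ∀ h ∈ diffSet I, ∀ s, |h s| < (p : ℤ) := by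
  obtain ⟨p, hp, h1, h2⟩ := Nat.exists_prime_lt_and_le_two_mul (max (diffSet I).ncard B)
    (lt_max_of_lt_right hB0).ne'
  refine ⟨p, h2, hp, (le_max_left _ _).trans h1.le, fun h hh s => (hB h hh s).trans_lt ?_⟩
  exact_mod_cast (le_max_right _ _).trans_lt h1

/-- Bertrand's postulate bounds the initial lattice size. -/
theorem cbcSize_le {I : Set (Fin d → ℤ)} {B : ℕ} (hB0 : 0 < B)
    (hB : ∀ h ∈ diffSet I, ∀ s, |h s| ≤ (B : ℤ)) :
    cbcSize I ≤ 2 * max (diffSet I).ncard B := by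
  obtain ⟨p, hp, h⟩ := exists_prime_cbcSize hB0 hB
  exact (Nat.sInf_le h).trans hp

theorem cbcSize_spec {I : Set (Fin d → ℤ)} (hI : I.Finite) :
    (cbcSize I).Prime ∧ (diffSet I).ncard ≤ cbcSize I ∧
      ∀ h ∈ diffSet I, ∀ s, |h s| < (cbcSize I : ℤ) := by
  have hne : {p : ℕ | p.Prime ∧ (diffSet I).ncard ≤ p ∧
      ∀ h ∈ diffSet I, ∀ s, |h s| < (p : ℤ)}.Nonempty := by
    have hD := diffSet_finite hI
    obtain ⟨p, -, h⟩ := exists_prime_cbcSize (I := I)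
      (B := 1 + ∑ h ∈ hD.toFinset, ∑ s, (h s).natAbs) (by omega) fun h hh s => by
        have h1 : (h s).natAbs ≤ ∑ s, (h s).natAbs :=
          Finset.single_le_sum (f := fun s => (h s).natAbs) (fun _ _ => Nat.zero_le _)
            (Finset.mem_univ s)
        have h2 : ∑ s, (h s).natAbs ≤ ∑ h ∈ hD.toFinset, ∑ s, (h s).natAbs :=
          Finset.single_le_sum (f := fun h : Fin d → ℤ => ∑ s, (h s).natAbs)
            (fun _ _ => Nat.zero_le _) (hD.mem_toFinset.2 hh)
        rw [Int.abs_eq_natAbs]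
        exact_mod_cast (h1.trans h2).trans (Nat.le_add_left _ _)
    exact ⟨p, h⟩
  exact Nat.sInf_mem hne

/-- Strictness leaves one residue free: zero is itself a difference unless `I` is empty. -/
theorem ncard_diffSet_diff_zero_lt {I : Set (Fin d → ℤ)} (hI : I.Finite) {N : ℕ} (hN : 0 < N)
    (h : (diffSet I).ncard ≤ N) : (diffSet I \ {0}).ncard < N := by
  by_cases h0 : (0 : Fin d → ℤ) ∈ diffSet I
  · exact (Set.ncard_sdiff_singleton_lt_of_mem h0 (diffSet_finite hI)).trans_le h
  · have : diffSet I = ∅ := by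
      refine Set.eq_empty_of_forall_notMem ?_
      rintro _ ⟨k, hk, l, hl, rfl⟩
      exact h0 ⟨k, hk, k, hk, (sub_self k).symm⟩
    simpa [this] using hN

/-- The next component of the generating vector can always be found. -/
theorem exists_next_component {I : Set (Fin d → ℤ)} (hI : I.Finite) {N : ℕ} (hN : N.Prime)
    (hcard : (diffSet I).ncard ≤ N) (hlt : ∀ h ∈ diffSet I, ∀ s, |h s| < (N : ℤ))
    (i : Fin d) (a : (Fin d → ℤ) → ℤ) :
    ∃ w : ℕ, w < N ∧ ∀ h ∈ diffSet I, (N : ℤ) ∣ a h + h i * w → h i = 0 := by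
  by_contra! hcon
  choose! H hH hdvd hne using hcon
  -- If one `h` excluded both `w` and `w'`, the prime `N` would divide `h i * (w - w')`, although
  -- both factors are smaller than `N` in absolute value and `h i ≠ 0`. So `N` excluded residues
  -- would need `N` nonzero differences.
  have hinj : Set.InjOn H (Finset.range N : Set ℕ) := by
    intro w hw w' hw' hww
    simp only [Finset.coe_range, Set.mem_Iio] at hw hw'
    have h1 := dvd_sub (hdvd w hw) (hww ▸ hdvd w' hw')
    rw [add_sub_add_left_eq_sub, ← mul_sub] at h1
    rcases (Nat.prime_iff_prime_int.1 hN).dvd_or_dvd h1 with h2 | h2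
    · exact absurd (Int.eq_zero_of_abs_lt_dvd h2 (hlt _ (hH w hw) i)) (hne w hw)
    · have h3 := Int.eq_zero_of_abs_lt_dvd h2 (by rw [abs_lt]; omega)
      omega
  have h1 := Set.ncard_le_ncard_of_injOn (t := diffSet I \ {0}) H (fun w hw => by
    simp only [Finset.coe_range, Set.mem_Iio] at hw
    exact ⟨hH w hw, fun h0 => hne w hw (by rw [h0]; rfl)⟩) hinj
    ((diffSet_finite hI).subset Set.sdiff_subset)
  rw [Set.ncard_coe_finset, Finset.card_range] at h1
  exact absurd (ncard_diffSet_diff_zero_lt hI hN.pos hcard) (not_lt.2 h1)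

theorem exists_isCBCVector {I : Set (Fin d → ℤ)} (hI : I.Finite) {N : ℕ} (hN : N.Prime)
    (hcard : (diffSet I).ncard ≤ N) (hlt : ∀ h ∈ diffSet I, ∀ s, |h s| < (N : ℤ)) :
    ∃ z, IsCBCVector I N z := by
  -- The invariant covers every prefix length `t ≤ s`, as every projection has to be reconstructed;
  -- entries not yet chosen are placeholders.
  have key : ∀ s ≤ d, ∃ z : Fin d → ℤ, (∀ i, 0 ≤ z i ∧ z i < N) ∧ ∀ t ≤ s, ∀ h ∈ diffSet I,
      (N : ℤ) ∣ ∑ i with i.val < t, h i * z i → ∀ i : Fin d, i.val < t → h i = 0 := by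
    intro s
    induction s with
    | zero =>
      refine fun _ => ⟨0, fun i => ⟨le_rfl, Int.natCast_pos.2 hN.pos⟩, fun t ht h _ _ i hi => ?_⟩
      omega
    | succ s ih =>
      intro hs
      obtain ⟨z, hz, hsep⟩ := ih (by omega)
      let i : Fin d := ⟨s, by omega⟩
      obtain ⟨w, hw, hwsep⟩ := exists_next_component hI hN hcard hlt i
        fun h => ∑ i with i.val < s, h i * z i
      have hold : ∀ t ≤ s, ∀ h : Fin d → ℤ,
          ∑ j with j.val < t, h j * Function.update z i w j = ∑ j with j.val < t, h j * z j := by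
        intro t ht h
        refine Finset.sum_congr rfl fun j hj => ?_
        have : j.val < t := (Finset.mem_filter.1 hj).2
        rw [Function.update_of_ne]
        rintro rfl
        exact absurd this (not_lt.2 ht)
      refine ⟨Function.update z i w, fun j => ?_, fun t ht h hh => ?_⟩
      · rcases eq_or_ne j i with rfl | hj
        · rw [Function.update_self]
          exact ⟨by positivity, by exact_mod_cast hw⟩
        · rw [Function.update_of_ne hj]
          exact hz j
      · rcases Nat.lt_or_ge s t with hst | hst
        · obtain rfl : t = s + 1 := by omega
          have h1 : (Finset.univ.filter fun j : Fin d => j.val < s + 1)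
              = insert i (Finset.univ.filter fun j : Fin d => j.val < s) := by
            ext j
            simp only [Finset.mem_filter, Finset.mem_univ, true_and, Finset.mem_insert,
              Fin.ext_iff, i]
            omega
          rw [h1, Finset.sum_insert (by simp [i]), hold s le_rfl, Function.update_self, add_comm]
          intro hdvd j hj
          have h2 := hwsep h hh hdvd
          rw [h2, zero_mul, add_zero] at hdvd
          rcases Nat.lt_or_ge j.val s with hjs | hjs
          · exact hsep s le_rfl h hh hdvd j hjs
          · rwa [show j = i from Fin.ext (by simp only [i]; omega)]
        · rw [hold t hst]
          exact hsep t hst h hh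
  obtain ⟨z, hz, hsep⟩ := key d le_rfl
  refine ⟨z, hz, fun s hs _ => ?_⟩
  rw [isReconstructing_iff (hI.image _)]
  refine ⟨hN.pos, ?_⟩
  rintro _ ⟨k, hk, rfl⟩ _ ⟨l, hl, rfl⟩ hdvd
  have h1 : (firstCoords hs k - firstCoords hs l) ⬝ᵥ firstCoords hs z
      = ∑ i with i.val < s, (k - l) i * z i := by
    refine Finset.sum_bij (fun i _ => Fin.castLE hs i) (fun i _ => by simp)
      (fun i _ j _ h => Fin.castLE_injective hs h) (fun j hj => ?_) (fun i _ => rfl)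
    exact ⟨⟨j, (Finset.mem_filter.1 hj).2⟩, Finset.mem_univ _, rfl⟩
  rw [h1] at hdvd
  funext i
  have := hsep s hs (k - l) ⟨k, hk, l, hl, rfl⟩ hdvd (Fin.castLE hs i) i.2
  exact sub_eq_zero.1 this

theorem exists_isCBCLattice {I : Set (Fin d → ℤ)} (hd : 1 ≤ d) (hI : I.Finite) :
    ∃ z M, IsCBCLattice I z M := by
  obtain ⟨hp, hcard, hlt⟩ := cbcSize_spec hI
  obtain ⟨z, hz⟩ := exists_isCBCVector hI hp hcard hlt
  refine ⟨z, cbcSize I, ?_, cbcSize I, le_rfl, le_rfl, hz⟩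
  have h := hz.2 d le_rfl hd
  rwa [show firstCoords (le_refl d) '' I = I from Set.image_id I] at h

end ComponentByComponent

/-! ### Comparing the lattice size with the refinement. -/

section LatticeSize

variable {d : ℕ}

/-- One coordinate axis suffices. There the level condition reads `(1 - T) * j ≤ (1 - T) * R + d -
1`, whose slack permits rounding `R` up. -/
theorem two_rpow_le_ncard_hypCross (hd : 2 ≤ d) {T R : ℝ} (hT0 : 0 ≤ T) (hT : T < 1)
    (hR : 0 ≤ R) : (2 : ℝ) ^ R ≤ (hypCross d T R).ncard := by
  set n := ⌈R⌉₊ with hn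
  let i : Fin d := ⟨0, by omega⟩
  have h1 : Set.MapsTo (fun a : ℤ => (Pi.single i a : Fin d → ℤ)) (Finset.Ioc (0 : ℤ) (2 ^ n))
      (hypCross d T R) := by
    intro a ha
    simp only [Finset.coe_Ioc, Set.mem_Ioc] at ha
    rw [mem_hypCross_iff]
    simp only [hypCrossLevels, Set.mem_ofPred_eq]
    have h2 : dyadicLevel a ≤ n := by
      rw [dyadicLevel_le_iff]
      zify
      rw [abs_of_pos ha.1]
      exact ha.2
    have h3 : ∑ s, (dyadicLevel ((Pi.single i a : Fin d → ℤ) s) : ℝ) = dyadicLevel a := by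
      rw [Finset.sum_eq_single i]
      · simp
      · intro s _ hs
        simp [hs, dyadicLevel]
      · simp
    have h4 : (dyadicLevel a : ℝ) ≤ ((Finset.univ.sup fun s =>
        dyadicLevel ((Pi.single i a : Fin d → ℤ) s) : ℕ) : ℝ) := by
      have := Finset.le_sup (f := fun s => dyadicLevel ((Pi.single i a : Fin d → ℤ) s))
        (Finset.mem_univ i)
      rw [Pi.single_eq_same] at this
      exact_mod_cast this
    have h5 : (dyadicLevel a : ℝ) ≤ R + 1 :=
      (Nat.cast_le.2 h2).trans (Nat.ceil_lt_add_one hR).le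
    have hd' : (2 : ℝ) ≤ d := by exact_mod_cast hd
    rw [h3]
    have h6 := mul_le_mul_of_nonneg_left h4 hT0
    have h7 := mul_le_mul_of_nonneg_left h5 (by linarith : 0 ≤ 1 - T)
    linarith
  have h2 := Set.ncard_le_ncard_of_injOn _ h1 (fun a _ b _ h => Pi.single_injective i h)
    (hypCross_finite d hT R)
  rw [Set.ncard_coe_finset, Int.card_Ioc, sub_zero] at h2
  have h3 : ((2 : ℤ) ^ n).toNat = 2 ^ n := by
    rw [← Int.toNat_natCast (2 ^ n)]
    simp
  rw [h3] at h2
  calc (2 : ℝ) ^ R ≤ 2 ^ (n : ℝ) := Real.rpow_le_rpow_of_exponent_le one_le_two (Nat.le_ceil R)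
    _ = ((2 ^ n : ℕ) : ℝ) := by rw [Real.rpow_natCast]; push_cast; rfl
    _ ≤ _ := by exact_mod_cast h2

theorem dyadicLevel_le_of_mem_hypCross {T R : ℝ} (hT : T < 1) {k : Fin d → ℤ}
    (hk : k ∈ hypCross d T R) (s : Fin d) :
    (dyadicLevel (k s) : ℝ) ≤ R + ((d : ℝ) - 1) / (1 - T) := by
  rw [mem_hypCross_iff] at hk
  simp only [hypCrossLevels, Set.mem_ofPred_eq] at hk
  obtain ⟨i, hi⟩ := exists_sup_eq (d := d) (by have := s.2; omega) fun s => dyadicLevel (k s)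
  have h1 : dyadicLevel (k s) ≤ Finset.univ.sup fun s => dyadicLevel (k s) :=
    Finset.le_sup (f := fun s => dyadicLevel (k s)) (Finset.mem_univ s)
  rw [hi] at hk h1
  have h2 : (dyadicLevel (k i) : ℝ) ≤ ∑ s, (dyadicLevel (k s) : ℝ) :=
    Finset.single_le_sum (f := fun s => (dyadicLevel (k s) : ℝ)) (fun _ _ => Nat.cast_nonneg _)
      (Finset.mem_univ i)
  have hT' : 0 < 1 - T := by linarith
  refine (Nat.cast_le.2 h1).trans ?_
  rw [← sub_le_iff_le_add', le_div_iff₀ hT']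
  linarith

theorem abs_le_of_mem_diffSet_hypCross {T R : ℝ} (hT : T < 1) {h : Fin d → ℤ}
    (hh : h ∈ diffSet (hypCross d T R)) (s : Fin d) :
    |(h s : ℝ)| ≤ 2 * 2 ^ (R + ((d : ℝ) - 1) / (1 - T)) := by
  have key : ∀ k ∈ hypCross d T R, |(k s : ℝ)| ≤ 2 ^ (R + ((d : ℝ) - 1) / (1 - T)) :=
    fun k hk => (abs_le_two_rpow_dyadicLevel _).trans
      (Real.rpow_le_rpow_of_exponent_le one_le_two (dyadicLevel_le_of_mem_hypCross hT hk s))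
  obtain ⟨k, hk, l, hl, rfl⟩ := hh
  rw [Pi.sub_apply, Int.cast_sub]
  exact (abs_sub _ _).trans (by linarith [key k hk, key l hl])

/-- The growth of the lattice size in terms of the refinement. -/
noncomputable def sizeGrowth (d : ℕ) (β R : ℝ) : ℝ :=
  2 ^ (2 * R) * (if β = 0 then R ^ (d - 2) else 1)

theorem two_rpow_le_sizeGrowth (d : ℕ) (β : ℝ) {R : ℝ} (hR : 1 ≤ R) :
    2 ^ (2 * R) ≤ sizeGrowth d β R := by
  unfold sizeGrowth
  refine le_mul_of_one_le_right (by positivity) ?_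
  split_ifs
  · exact one_le_pow₀ hR
  · exact le_rfl

theorem ncard_diffSet_hypCross_le (hd : 2 ≤ d) {α β : ℝ} (hα : 0 < α) (hβ : β ≤ 0)
    (hαβ : 0 < α + β) : ∃ K : ℝ, 0 < K ∧ ∀ R : ℝ, 1 ≤ R →
      ((diffSet (hypCross d (-β / α) R)).ncard : ℝ) ≤ K * sizeGrowth d β R := by
  obtain ⟨K, hK, h⟩ : ∃ K : ℝ≥0∞, K ≠ ∞ ∧ ∀ R : ℝ, 1 ≤ R →
      ((diffSet (hypCross d (-β / α) R)).encard : ℝ≥0∞)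
        ≤ K * ENNReal.ofReal (sizeGrowth d β R) := by
    rcases hβ.lt_or_eq with hβ | rfl
    · obtain ⟨K, hK, h⟩ := encard_hypCross_le_of_neg (d := d) (by omega) hβ hαβ
      refine ⟨K * K, ENNReal.mul_ne_top hK hK, fun R hR => ?_⟩
      have h1 : ((diffSet (hypCross d (-β / α) R)).encard : ℝ≥0∞) ≤
          (hypCross d (-β / α) R).encard * (hypCross d (-β / α) R).encard := by
        rw [← ENat.toENNReal_mul]
        exact ENat.toENNReal_mono (encard_diffSet_le _)
      refine (h1.trans (mul_le_mul' (h R) (h R))).trans (le_of_eq ?_)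
      rw [sizeGrowth, if_neg hβ.ne, mul_one, ofReal_two_rpow, two_mul, two_rpow_add]
      ring
    · obtain ⟨K, hK, h⟩ := encard_diffSet_hypCross_zero_le hd
      refine ⟨K, hK, fun R hR => ?_⟩
      rw [sizeGrowth, if_pos rfl, ENNReal.ofReal_mul (by positivity), ofReal_two_rpow,
        ENNReal.ofReal_pow (by linarith), neg_zero, zero_div]
      exact h R hR
  refine ⟨K.toReal + 1, by positivity, fun R hR => ?_⟩
  have hpos : 0 < sizeGrowth d β R :=
    lt_of_lt_of_le (by positivity) (two_rpow_le_sizeGrowth d β hR)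
  have h1 := h R hR
  rw [← (diffSet_finite (hypCross_finite d (neg_div_lt_one hα hαβ) R)).cast_ncard_eq,
    ENat.toENNReal_coe] at h1
  have h2 := ENNReal.toReal_mono (ENNReal.mul_ne_top hK ENNReal.ofReal_ne_top) h1
  rw [ENNReal.toReal_natCast, ENNReal.toReal_mul, ENNReal.toReal_ofReal hpos.le] at h2
  linarith

/-- Coordinates of differences are only of order `2 ^ R`, so the bound on the number of differences
dominates. -/
theorem cbcSize_hypCross_le (hd : 2 ≤ d) {α β : ℝ} (hα : 0 < α) (hβ : β ≤ 0)
    (hαβ : 0 < α + β) : ∃ K : ℝ, 0 < K ∧ ∀ R : ℝ, 1 ≤ R →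
      (cbcSize (hypCross d (-β / α) R) : ℝ) ≤ K * sizeGrowth d β R := by
  obtain ⟨K, hK, h⟩ := ncard_diffSet_hypCross_le hd hα hβ hαβ
  have hT := neg_div_lt_one hα hαβ
  set ρ := ((d : ℝ) - 1) / (1 - -β / α) with hρ
  have hρ0 : 0 ≤ ρ := by
    have : (2 : ℝ) ≤ d := by exact_mod_cast hd
    exact div_nonneg (by linarith) (by linarith)
  refine ⟨2 * (K + 2 * 2 ^ ρ), by positivity, fun R hR => ?_⟩
  have hg := two_rpow_le_sizeGrowth d β hR
  have hpos : 0 < sizeGrowth d β R := lt_of_lt_of_le (by positivity) hg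
  have hone : (1 : ℝ) ≤ 2 ^ (R + ρ) := Real.one_le_rpow one_le_two (by linarith)
  have hB0 : 0 < ⌊2 * (2 : ℝ) ^ (R + ρ)⌋₊ := Nat.floor_pos.2 (by linarith)
  have h1 := cbcSize_le (I := hypCross d (-β / α) R) hB0 fun k hk s => by
    have h2 := abs_le_of_mem_diffSet_hypCross hT hk s
    rw [Int.abs_eq_natAbs, Nat.cast_le]
    refine Nat.le_floor ?_
    rwa [Nat.cast_natAbs, Int.cast_abs]
  have h2 : (⌊2 * (2 : ℝ) ^ (R + ρ)⌋₊ : ℝ) ≤ 2 * 2 ^ ρ * sizeGrowth d β R := by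
    refine (Nat.floor_le (by positivity)).trans ?_
    rw [add_comm, Real.rpow_add two_pos, ← mul_assoc]
    refine mul_le_mul_of_nonneg_left (le_trans ?_ hg) (by positivity)
    exact Real.rpow_le_rpow_of_exponent_le one_le_two (by linarith)
  have h3 : (cbcSize (hypCross d (-β / α) R) : ℝ) ≤
      2 * max ((diffSet (hypCross d (-β / α) R)).ncard : ℝ) (⌊2 * (2 : ℝ) ^ (R + ρ)⌋₊ : ℝ) := by
    exact_mod_cast h1
  refine h3.trans ?_
  rw [mul_assoc]
  refine mul_le_mul_of_nonneg_left (max_le ?_ ?_) two_pos.le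
  · refine (h R hR).trans (mul_le_mul_of_nonneg_right ?_ hpos.le)
    linarith [show (0 : ℝ) < 2 * 2 ^ ρ by positivity]
  · refine h2.trans (mul_le_mul_of_nonneg_right ?_ hpos.le)
    linarith

/-- The upper bound on `M` controls the negative power of `M`, losing `R ^ ((d - 2) / 2 * γ)` when
`β = 0`. The lower bound gives `R * log 2 ≤ log M`, so the extra logarithms in the rate compensate
for this loss. -/
theorem refinementRate_le_latticeSizeRate (hd : 2 ≤ d) {α β : ℝ}
    (hαβ : 1 / 2 < α + β) {K : ℝ} (hK : 0 < K) : ∃ C : ℝ, 0 < C ∧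
      ∀ R : ℝ, 1 ≤ R → ∀ M : ℕ, (2 : ℝ) ^ R ≤ M → (M : ℝ) ≤ K * sizeGrowth d β R →
        refinementRate d α β R ≤ C * latticeSizeRate d α β M := by
  set γ := α + β - 1 / 2 with hγ
  have hγ0 : 0 < γ := by linarith
  set p := ((d : ℝ) - 2) / 2 * (α - 1 / 2) + ((d : ℝ) - 1) / 2 with hp
  have hl2 : 0 < Real.log 2 := Real.log_pos one_lt_two
  refine ⟨K ^ (γ / 2) * (if β = 0 then (Real.log 2 ^ p)⁻¹ else 1), ?_, fun R hR M hM1 hM2 => ?_⟩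
  · split_ifs <;> positivity
  have hR0 : 0 < R := by linarith
  have hM0 : (0 : ℝ) < M := lt_of_lt_of_le (by positivity) hM1
  have hg0 : 0 < sizeGrowth d β R :=
    lt_of_lt_of_le (by positivity) (two_rpow_le_sizeGrowth d β hR)
  have h1 : (sizeGrowth d β R) ^ (-γ / 2) ≤ K ^ (γ / 2) * (M : ℝ) ^ (-γ / 2) := by
    have h2 := Real.rpow_le_rpow_of_nonpos hM0 hM2 (by linarith : -γ / 2 ≤ 0)
    rw [Real.mul_rpow hK.le hg0.le, neg_div, Real.rpow_neg hK.le, ← div_eq_inv_mul,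
      div_le_iff₀ (by positivity), ← neg_div, mul_comm] at h2
    exact h2
  have h3 : (sizeGrowth d β R) ^ (-γ / 2)
      = 2 ^ (-γ * R) * (if β = 0 then R ^ (-(((d : ℝ) - 2) / 2 * γ)) else 1) := by
    unfold sizeGrowth
    rw [Real.mul_rpow (by positivity) (by split_ifs <;> positivity), ← Real.rpow_mul two_pos.le]
    congr 1
    · ring_nf
    · split_ifs
      · rw [← Real.rpow_natCast, ← Real.rpow_mul hR0.le]
        push_cast [Nat.cast_sub hd]
        ring_nf
      · exact Real.one_rpow _
  rw [h3] at h1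
  unfold refinementRate latticeSizeRate
  rw [← hγ, ← hp]
  split_ifs at h1 ⊢ with hβ0
  · have hγα : γ = α - 1 / 2 := by rw [hγ, hβ0, add_zero]
    have hp0 : 0 ≤ p := by
      have hd' : (2 : ℝ) ≤ d := by exact_mod_cast hd
      rw [hp, ← hγα]
      have : 0 ≤ ((d : ℝ) - 2) / 2 * γ := mul_nonneg (by linarith) hγ0.le
      linarith
    have hlog : R * Real.log 2 ≤ Real.log M := by
      rw [← Real.log_rpow two_pos]
      exact Real.log_le_log (by positivity) hM1
    have h4 : R ^ p * Real.log 2 ^ p ≤ Real.log M ^ p := by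
      rw [← Real.mul_rpow hR0.le hl2.le]
      exact Real.rpow_le_rpow (by positivity) hlog hp0
    have h5 : R ^ (((d : ℝ) - 1) / 2) = R ^ (-(((d : ℝ) - 2) / 2 * γ)) * R ^ p := by
      rw [← Real.rpow_add hR0, hp, hγα]
      ring_nf
    have h6 : R ^ p ≤ (Real.log 2 ^ p)⁻¹ * Real.log M ^ p := by
      rw [← div_eq_inv_mul, le_div_iff₀ (by positivity)]
      exact h4
    calc 2 ^ (-γ * R) * R ^ (((d : ℝ) - 1) / 2)
        = 2 ^ (-γ * R) * R ^ (-(((d : ℝ) - 2) / 2 * γ)) * R ^ p := by rw [h5, mul_assoc]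
      _ ≤ (K ^ (γ / 2) * (M : ℝ) ^ (-γ / 2)) * ((Real.log 2 ^ p)⁻¹ * Real.log M ^ p) :=
          mul_le_mul h1 h6 (by positivity) (by positivity)
      _ = _ := by ring
  · simpa using h1

end LatticeSize

theorem mainTheorem8 (d : ℕ) (hd : 2 ≤ d) (α β : ℝ) (hα : 1 / 2 < α) (hβ : β ≤ 0)
    (hαβ : 1 / 2 < α + β) :
    -- every element of `H^{α,β}` has a continuous representative (so it can be sampled)
    (∀ f : Lp ℂ 2 (torusMeasure d), hybridNorm α β f < ∞ → ∃ g, IsContRep f g) ∧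
    ∃ C : ℝ, 0 < C ∧ ∀ R : ℝ, 1 ≤ R →
      -- the bound in `R`, for every reconstructing rank-1 lattice
      (∀ (z : Fin d → ℤ) (M : ℕ), IsReconstructing (hypCross d (-β / α) R) z M →
        samplingError α β (hypCross d (-β / α) R) z M
          ≤ ENNReal.ofReal (C * refinementRate d α β R)) ∧
      -- component-by-component lattices exist, and satisfy in addition the bound in `M`
      (∃ (z : Fin d → ℤ) (M : ℕ), IsCBCLattice (hypCross d (-β / α) R) z M) ∧
      (∀ (z : Fin d → ℤ) (M : ℕ), IsCBCLattice (hypCross d (-β / α) R) z M →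
        refinementRate d α β R ≤ C * latticeSizeRate d α β M ∧
        samplingError α β (hypCross d (-β / α) R) z M
          ≤ ENNReal.ofReal (C * latticeSizeRate d α β M)) := by
  have hα0 : 0 < α := by linarith
  have hαβ0 : 0 < α + β := by linarith
  have hT : -β / α < 1 := neg_div_lt_one hα0 hαβ0
  have hT0 : 0 ≤ -β / α := div_nonneg (by linarith) hα0.le
  have hW := tsum_inv_hybridWeight_ne_top hd hα hβ hαβ
  refine ⟨fun f hf => exists_isContRep (summable_mFourierCoeff (α := α) (β := β) ?_ hW), ?_⟩
  · rw [hybridNorm_eq] at hf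
    exact (ENNReal.rpow_lt_top_iff_of_pos (by norm_num)).1 hf
  obtain ⟨C₁, hC₁, htail⟩ := tsum_compl_hypCross_le hd hα hβ hαβ
  obtain ⟨K, hK, hsize⟩ := cbcSize_hypCross_le hd hα0 hβ hαβ0
  obtain ⟨C₂, hC₂, hrate⟩ := refinementRate_le_latticeSizeRate hd (α := α) hαβ hK
  have herr : ∀ R : ℝ, 1 ≤ R → ∀ (z : Fin d → ℤ) (M : ℕ),
      IsReconstructing (hypCross d (-β / α) R) z M →
        samplingError α β (hypCross d (-β / α) R) z M
          ≤ ENNReal.ofReal (4 * C₁ * refinementRate d α β R) := by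
    intro R hR z M h
    rw [mul_assoc]
    exact samplingError_le (hypCross_finite d hT R) h hW
      (mul_pos hC₁ (refinementRate_pos d α β hR)) (htail R hR)
  -- The summands serve, in turn, the error bound in `R`, the comparison of rates, and the error
  -- bound in `M`.
  refine ⟨4 * C₁ + C₂ + 4 * C₁ * C₂, by positivity, fun R hR => ⟨fun z M h => ?_, ?_,
    fun z M h => ?_⟩⟩
  · refine (herr R hR z M h).trans (ENNReal.ofReal_le_ofReal ?_)
    refine mul_le_mul_of_nonneg_right ?_ (refinementRate_pos d α β hR).le
    linarith [mul_pos hC₁ hC₂]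
  · exact exists_isCBCLattice (by omega) (hypCross_finite d hT R)
  · obtain ⟨hrec, N, hMN, hN, -⟩ := h
    have hM1 : (2 : ℝ) ^ R ≤ M :=
      (two_rpow_le_ncard_hypCross hd hT0 hT (by linarith)).trans
        (Nat.cast_le.2 (hrec.ncard_le (hypCross_finite d hT R)))
    have hM2 : (M : ℝ) ≤ K * sizeGrowth d β R :=
      (Nat.cast_le.2 (hMN.trans hN)).trans (hsize R hR)
    have h1 := hrate R hR M hM1 hM2
    have hpos : 0 < latticeSizeRate d α β M :=
      pos_of_mul_pos_right ((refinementRate_pos d α β hR).trans_le h1) hC₂.le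
    refine ⟨h1.trans (mul_le_mul_of_nonneg_right ?_ hpos.le), (herr R hR z M hrec).trans
      (ENNReal.ofReal_le_ofReal ?_)⟩
    · linarith [mul_pos hC₁ hC₂]
    · calc 4 * C₁ * refinementRate d α β R ≤ 4 * C₁ * (C₂ * latticeSizeRate d α β M) := by gcongr
        _ = 4 * C₁ * C₂ * latticeSizeRate d α β M := by ring
        _ ≤ _ := mul_le_mul_of_nonneg_right (by linarith) hpos.le
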